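/- Let $M$ be an $n$-dimensional smooth manifold with a distance that induces its topology and for which closed balls are compact, and let $\lambda$ be a volume measure on $M$ (a Borel measure with positive continuous density with respect to Lebesgue measure in every chart). Let $X_1,\dots,X_m$ be smooth vector fields, $\nabla\varphi=(X_1\varphi,\dots,X_m\varphi)$ the corresponding (sub)gradient and $|\nabla\varphi|$ its Euclidean length. A test function is a function $M\to\mathbb R$ that is differentiable $\lambda$-a.e. and is smooth or locally Lipschitz for the distance. The distance is assumed to be compatible with $\nabla$: for some $L<\infty$, every test function $\varphi$ with $|\nabla\varphi|\le 1$ a.e. is $L$-Lipschitz (that is, the intrinsic distance of $\nabla$ is at most $L$ times the distance). Examples are $\mathbb R^n$ with the Euclidean distance and the Heisenberg group with the Carnot–Carathéodory distance. Fix $x_0\in M$, let $d(x)$ be the distance from $x_0$ to $x$, and $B_R=\{d<R\}$. Assume: (i) for some $\sigma\ge1$, $\frac1\sigma<|\nabla d|\le 1$ $\lambda$-a.e.; (ii) for some $K>0$, $\Delta d\le K$ on $\{d>1\}$ in the weak sense: $-\int\nabla d\cdot\nabla\varphi\,d\lambda\le K\int\varphi\,d\lambda$ for every nonnegative test function $\varphi$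 with compact support contained in $\{d>1\}$ for which $\nabla d\cdot\nabla\varphi$ is $\lambda$-integrable; (iii) for some $\epsilon,\alpha,\beta>0$, $\left(\int|\varphi|^{2+\epsilon}d\lambda\right)^{\frac2{2+\epsilon}}\le\alpha\int|\nabla\varphi|^2d\lambda+\beta\int|\varphi|^2d\lambda$ for all compactly supported test functions $\varphi$; (iv) for every $R>0$ there is $c_R<\infty$ such that $\frac1{\lambda(B_R)}\int_{B_R}\left|\varphi-\frac1{\lambda(B_R)}\int_{B_R}\varphi\,d\lambda\right|^2d\lambda\le \frac{c_R}{\lambda(B_R)}\int_{B_R}|\nabla\varphi|^2d\lambda$ for all test functions $\varphi$. Then there is $\delta_0\in(0,1)$ such that the following holds. Let $q>2$, $1<p<2$, $p\ge\frac q{q-1}$, $0<\delta\le\delta_0$, $\gamma_\delta>0$, and let $W$ be a test function with $|\nabla W|\le\delta d^{p-1}+\gamma_\delta$ $\lambda$-a.e. Let $d\mu_p=\frac{e^{-d^p}}{Z_p}d\lambda$ and $d\mu=\frac{e^{-W}}{Z}d\mu_p$, where $Z_p$ and $Z$ are normalization constants, and suppose that $\mu$ is a probability measure. With $H_q(x)=x^2$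 for $|x|\le1$ and $H_q(x)=|x|^q$ for $|x|\ge1$, there is a constant $c>0$ such that $$\int f^2\log\frac{f^2}{\int f^2d\mu}\,d\mu\le c\int H_q\!\left(\frac{|\nabla f|}{f}\right)f^2\,d\mu$$ for every test function $f\in L^2(\mu)$, in particular for every $f\in C^\infty(M)\cap L^2(\mu)$. (The integrand on the right is read as $0$ where $f=0$; if the right side is finite, $f^2\log\frac{f^2}{\int f^2d\mu}$ is $\mu$-integrable.) -/

import Mathlib

open MeasureTheory Set
open scoped Manifold ContDiff ENNReal NNReal

noncomputable section

/-- The (sub)gradient `∇φ = (X₁ φ, …, X_m φ)` of a real function, for a finite family of vector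
fields `X₁, …, X_m`. Its Euclidean norm is `|∇φ|`. -/
def subgrad {n m : ℕ} {M : Type*} [TopologicalSpace M] [ChartedSpace (EuclideanSpace ℝ (Fin n)) M]
    (X : Fin m → (x : M) → TangentSpace 𝓘(ℝ, EuclideanSpace ℝ (Fin n)) x)
    (φ : M → ℝ) (x : M) : EuclideanSpace ℝ (Fin m) :=
  WithLp.toLp 2 fun i =>
    (mfderiv 𝓘(ℝ, EuclideanSpace ℝ (Fin n)) 𝓘(ℝ, ℝ) φ x (X i x) : ℝ)

/-- The functions on which the inequalities are tested: functions that are smooth or locally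
Lipschitz for the distance, and differentiable almost everywhere. -/
def IsTestFunction (n : ℕ) {M : Type*} [MetricSpace M]
    [ChartedSpace (EuclideanSpace ℝ (Fin n)) M] [MeasurableSpace M]
    (ν : Measure M) (φ : M → ℝ) : Prop :=
  (ContMDiff 𝓘(ℝ, EuclideanSpace ℝ (Fin n)) 𝓘(ℝ, ℝ) ∞ φ ∨ LocallyLipschitz φ) ∧
    ∀ᵐ x ∂ν, MDifferentiableAt 𝓘(ℝ, EuclideanSpace ℝ (Fin n)) 𝓘(ℝ, ℝ) φ x

/-- `lam` is a volume (Lebesgue) measure on the `n`-dimensional manifold `M`: in each chart it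
has a positive continuous density with respect to the Lebesgue measure of `ℝⁿ`. -/
def IsVolume (n : ℕ) {M : Type*} [TopologicalSpace M]
    [ChartedSpace (EuclideanSpace ℝ (Fin n)) M] [MeasurableSpace M] (lam : Measure M) : Prop :=
  ∀ e ∈ atlas (EuclideanSpace ℝ (Fin n)) M, ∃ ρ : EuclideanSpace ℝ (Fin n) → ℝ,
    ContinuousOn ρ e.target ∧ (∀ y ∈ e.target, 0 < ρ y) ∧
      ∀ s : Set M, MeasurableSet s → s ⊆ e.source →
        lam s = ∫⁻ y in e '' s, ENNReal.ofReal (ρ y)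

/-- The intrinsic distance of the (sub)gradient:
`sup {|φ x - φ y| : |∇φ| ≤ 1 almost everywhere}`. -/
def intrinsicEDist {n m : ℕ} {M : Type*} [MetricSpace M]
    [ChartedSpace (EuclideanSpace ℝ (Fin n)) M] [MeasurableSpace M]
    (X : Fin m → (x : M) → TangentSpace 𝓘(ℝ, EuclideanSpace ℝ (Fin n)) x)
    (lam : Measure M) (x y : M) : ℝ≥0∞ :=
  ⨆ (φ : M → ℝ) (_ : IsTestFunction n lam φ) (_ : ∀ᵐ z ∂lam, ‖subgrad X φ z‖ ≤ 1),
    edist (φ x) (φ y)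

/-- `Δu ≤ K` on the set `A` in the weak sense, where `Δ = - ∇* ∇` with respect to `lam`:
`- ∫ ∇u · ∇φ dλ ≤ K ∫ φ dλ` for all nonnegative compactly supported `φ` with support in `A`. -/
def LaplacianLEOn {n m : ℕ} {M : Type*} [MetricSpace M]
    [ChartedSpace (EuclideanSpace ℝ (Fin n)) M] [MeasurableSpace M]
    (X : Fin m → (x : M) → TangentSpace 𝓘(ℝ, EuclideanSpace ℝ (Fin n)) x)
    (lam : Measure M) (u : M → ℝ) (A : Set M) (K : ℝ) : Prop :=
  ∀ φ : M → ℝ, IsTestFunction n lam φ → HasCompactSupport φ → tsupport φ ⊆ A →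
    (∀ x, 0 ≤ φ x) →
    Integrable (fun x => inner ℝ (subgrad X u x) (subgrad X φ x)) lam →
      -(∫ x, inner ℝ (subgrad X u x) (subgrad X φ x) ∂lam) ≤ K * ∫ x, φ x ∂lam

/-- The classical Sobolev inequality
`(∫ |φ|^(2+ε) dλ)^(2/(2+ε)) ≤ α ∫ |∇φ|² dλ + β ∫ |φ|² dλ` for compactly supported `φ`. -/
def ClassicalSobolev {n m : ℕ} {M : Type*} [MetricSpace M]
    [ChartedSpace (EuclideanSpace ℝ (Fin n)) M] [MeasurableSpace M]
    (X : Fin m → (x : M) → TangentSpace 𝓘(ℝ, EuclideanSpace ℝ (Fin n)) x)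
    (lam : Measure M) (ε α β : ℝ) : Prop :=
  ∀ φ : M → ℝ, IsTestFunction n lam φ → HasCompactSupport φ →
    (∫⁻ x, ‖φ x‖ₑ ^ (2 + ε) ∂lam) ^ (2 / (2 + ε)) ≤
      ENNReal.ofReal α * (∫⁻ x, ‖subgrad X φ x‖ₑ ^ 2 ∂lam) +
        ENNReal.ofReal β * ∫⁻ x, ‖φ x‖ₑ ^ 2 ∂lam

/-- The local Poincaré inequality on the balls `B_R = {d < R}` around `x₀`, with a constant
that may depend on the radius. -/
def LocalPoincare {n m : ℕ} {M : Type*} [MetricSpace M]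
    [ChartedSpace (EuclideanSpace ℝ (Fin n)) M] [MeasurableSpace M]
    (X : Fin m → (x : M) → TangentSpace 𝓘(ℝ, EuclideanSpace ℝ (Fin n)) x)
    (lam : Measure M) (x₀ : M) : Prop :=
  ∀ R : ℝ, 0 < R → ∃ c : ℝ, 0 < c ∧ ∀ φ : M → ℝ, IsTestFunction n lam φ →
    ⨍⁻ x in Metric.ball x₀ R, ‖φ x - ⨍ y in Metric.ball x₀ R, φ y ∂lam‖ₑ ^ 2 ∂lam ≤
      ENNReal.ofReal c * ⨍⁻ x in Metric.ball x₀ R, ‖subgrad X φ x‖ₑ ^ 2 ∂lam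

/-- The modification `H_q` of `|x|^q`: it is `x²` for `|x| ≤ 1` and `|x|^q` for `|x| ≥ 1`. -/
def Hq (q x : ℝ) : ℝ := if |x| ≤ 1 then x ^ 2 else |x| ^ q

/-- The (tight) modified logarithmic Sobolev inequality `MLS(H_q)` for `μ`:
`∫ f² log (f² / ∫ f² dμ) dμ ≤ c ∫ H_q(|∇f| / f) f² dμ`, with `c` independent of `f`.
There is nothing to prove when the nonnegative integrand on the right is not integrable; when it
is, the left-hand side is part of the claim as an integrable function. Where `f = 0`, the integrand
on the right is read as `0`; for an absolutely continuous `μ` this is harmless, as `∇f` vanishes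
almost everywhere on `{f = 0}`. -/
def ModifiedLogSobolev {n m : ℕ} {M : Type*} [MetricSpace M]
    [ChartedSpace (EuclideanSpace ℝ (Fin n)) M] [MeasurableSpace M]
    (X : Fin m → (x : M) → TangentSpace 𝓘(ℝ, EuclideanSpace ℝ (Fin n)) x)
    (μ : Measure M) (q : ℝ) : Prop :=
  ∃ c : ℝ, 0 < c ∧ ∀ f : M → ℝ, IsTestFunction n μ f → MemLp f 2 μ →
    Integrable (fun x => Hq q (‖subgrad X f x‖ / f x) * f x ^ 2) μ →
      Integrable (fun x => f x ^ 2 * Real.log (f x ^ 2 / ∫ y, f y ^ 2 ∂μ)) μ ∧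
      ∫ x, f x ^ 2 * Real.log (f x ^ 2 / ∫ y, f y ^ 2 ∂μ) ∂μ ≤
        c * ∫ x, Hq q (‖subgrad X f x‖ / f x) * f x ^ 2 ∂μ

/-- The measure `dμ_p = e^{-d^p} dλ / Z_p`, with `d` the distance from `x₀`. -/
def muP {M : Type*} [MetricSpace M] [MeasurableSpace M] (lam : Measure M) (x₀ : M) (p : ℝ) :
    Measure M :=
  lam.tilted fun x => -(dist x₀ x ^ p)

end

/-! Write $r=p-1$ and $d\mu=e^{-U}d\lambda$ with $U=d^p+W+\mathrm{const}$. Since $|\nabla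
d|>1/\sigma$ and $\delta\le 1/(2\sigma^2)$, the potential still pushes inwards: $\nabla d\cdot\nabla
U\ge c\,d^r-\gamma$. Testing $\Delta d\le K$ against $ge^{-U}$ turns this into a U-bound in the
sense of Hebisch and Zegarliński, $\int g\,d^r\,d\mu\le C\int(|\nabla g|+g)\,d\mu$ for $g\ge0$
(`lintegral_mul_dist_rpow_le`).

Everything else rests on this bound. Applied to $(v-k)^2$ it controls the mass outside a large ball,
and with the local Poincaré inequality inside the ball it gives a Poincaré inequality for $\mu$
(`poincare`). Applied to $g^2d$ it bounds $\int g^2d^p\,d\mu$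
(`lintegral_sq_mul_dist_rpow_add_one_le`); the cross term $d\,|g||\nabla g|$ is split by Young's
inequality with exponents $p$ and $p'=p/(p-1)$ and leaves $(|\nabla g|/|g|)^{p'}g^2$. As $2\le p'\le
q$, this is at most $H_q(|\nabla g|/g)g^2$. The Sobolev inequality for $ge^{-U/2}$, with a tangent
line of the logarithm, gives a defective inequality: the entropy of $g^2$ is at most a multiple of
$\int|\nabla g|^2+g^2(1+d^p)\,d\mu$ (`defective_logSobolev`).

The defect is removed by truncation. Normalise $\int f^2d\mu=1$ and let $g$ be a smooth truncation
of $f$ that vanishes for $f^2\le2$ and equals $f$ for $f^2\ge3$. Pointwise, $f^2\log f^2\le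
f^2-1+25(|f|-1)^2+g^2\log g^2$. The term $f^2-1$ integrates to zero. Poincaré bounds
$\int(|f|-1)^2$, hence also $\int g^2$, since $g^2\le16(|f|-1)^2$. The defective inequality and the
bound on $\int g^2d^p$ handle the last term without leaving a multiple of $\int f^2$. -/

open Filter Topology

/-! ### Calculus of the subgradient. -/

section Calculus

variable {n m : ℕ} {M : Type*} [MetricSpace M] [ChartedSpace (EuclideanSpace ℝ (Fin n)) M]
  (X : Fin m → (x : M) → TangentSpace 𝓘(ℝ, EuclideanSpace ℝ (Fin n)) x)

lemma subgrad_comp {f : M → ℝ} {x : M} {Φ : ℝ → ℝ} {c : ℝ}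
    (hf : MDifferentiableAt 𝓘(ℝ, EuclideanSpace ℝ (Fin n)) 𝓘(ℝ, ℝ) f x)
    (hΦ : HasDerivAt Φ c (f x)) :
    subgrad X (fun y => Φ (f y)) x = c • subgrad X f x := by
  have h := HasMFDerivAt.comp x hΦ.hasFDerivAt.hasMFDerivAt hf.hasMFDerivAt
  ext i
  have h2 := h.mfderiv
  change mfderiv _ _ (Φ ∘ f) x (X i x) = c * _
  rw [h2]
  exact mul_comm (G := ℝ) (mfderiv 𝓘(ℝ, EuclideanSpace ℝ (Fin n)) 𝓘(ℝ, ℝ) f x (X i x)) c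

lemma MDifferentiableAt.comp_real {f : M → ℝ} {x : M} {Φ : ℝ → ℝ}
    (hf : MDifferentiableAt 𝓘(ℝ, EuclideanSpace ℝ (Fin n)) 𝓘(ℝ, ℝ) f x)
    (hΦ : DifferentiableAt ℝ Φ (f x)) :
    MDifferentiableAt 𝓘(ℝ, EuclideanSpace ℝ (Fin n)) 𝓘(ℝ, ℝ) (fun y => Φ (f y)) x :=
  (HasMFDerivAt.comp x hΦ.hasFDerivAt.hasMFDerivAt hf.hasMFDerivAt).mdifferentiableAt

lemma subgrad_add {f g : M → ℝ} {x : M}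
    (hf : MDifferentiableAt 𝓘(ℝ, EuclideanSpace ℝ (Fin n)) 𝓘(ℝ, ℝ) f x)
    (hg : MDifferentiableAt 𝓘(ℝ, EuclideanSpace ℝ (Fin n)) 𝓘(ℝ, ℝ) g x) :
    subgrad X (fun y => f y + g y) x = subgrad X f x + subgrad X g x := by
  have h := (hf.hasMFDerivAt.add hg.hasMFDerivAt).mfderiv
  ext i
  change mfderiv _ _ (f + g) x (X i x) = _
  rw [h]
  rfl

lemma subgrad_mul {f g : M → ℝ} {x : M}
    (hf : MDifferentiableAt 𝓘(ℝ, EuclideanSpace ℝ (Fin n)) 𝓘(ℝ, ℝ) f x)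
    (hg : MDifferentiableAt 𝓘(ℝ, EuclideanSpace ℝ (Fin n)) 𝓘(ℝ, ℝ) g x) :
    subgrad X (fun y => f y * g y) x = f x • subgrad X g x + g x • subgrad X f x := by
  have h := (hf.hasMFDerivAt.mul hg.hasMFDerivAt).mfderiv
  ext i
  change mfderiv _ _ (f * g) x (X i x) = _
  rw [h]
  rfl

/-- `mfderiv` is zero by convention where the derivative does not exist. Hence the hypothesis
$|\nabla d|>1/\sigma$ already contains the a.e. differentiability of $d$. -/
lemma mdifferentiableAt_of_subgrad_ne_zero {f : M → ℝ} {x : M} (h : subgrad X f x ≠ 0) :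
    MDifferentiableAt 𝓘(ℝ, EuclideanSpace ℝ (Fin n)) 𝓘(ℝ, ℝ) f x := by
  by_contra hc
  apply h
  ext i
  change mfderiv _ _ f x (X i x) = 0
  rw [mfderiv_zero_of_not_mdifferentiableAt hc]
  rfl

variable [IsManifold 𝓘(ℝ, EuclideanSpace ℝ (Fin n)) ∞ M]

/-- Reading the derivative in one fixed chart reduces continuity and measurability of the
subgradient to statements about `fderiv` on $\mathbb R^n$. -/
lemma mfderiv_apply_eq_fderiv_chart {f : M → ℝ} {x x₁ : M}
    (hx : x ∈ (chartAt (EuclideanSpace ℝ (Fin n)) x₁).source)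
    (hf : MDifferentiableAt 𝓘(ℝ, EuclideanSpace ℝ (Fin n)) 𝓘(ℝ, ℝ) f x)
    (v : TangentSpace 𝓘(ℝ, EuclideanSpace ℝ (Fin n)) x) :
    mfderiv 𝓘(ℝ, EuclideanSpace ℝ (Fin n)) 𝓘(ℝ, ℝ) f x v =
      fderiv ℝ (f ∘ (extChartAt 𝓘(ℝ, EuclideanSpace ℝ (Fin n)) x₁).symm)
        (extChartAt 𝓘(ℝ, EuclideanSpace ℝ (Fin n)) x₁ x)
        ((trivializationAt (EuclideanSpace ℝ (Fin n))
          (TangentSpace 𝓘(ℝ, EuclideanSpace ℝ (Fin n))) x₁ ⟨x, v⟩).2) := by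
  have : IsManifold (𝓡 n) 1 M := IsManifold.of_le (n := ∞) (by norm_cast)
  set e := extChartAt (𝓡 n) x₁ with he
  have hxe : x ∈ e.source := by rw [he, extChartAt_source (𝓡 n)]; exact hx
  have hsymm : MDifferentiableAt (𝓡 n) (𝓡 n) e.symm (e x) := by
    have := mdifferentiableWithinAt_extChartAt_symm (I := 𝓡 n) (x := x₁) (e.map_source hxe)
    rwa [show range (𝓡 n) = univ from ModelWithCorners.range_eq_univ _,
      mdifferentiableWithinAt_univ] at this
  have hfe : MDifferentiableAt (𝓡 n) 𝓘(ℝ, ℝ) (f ∘ e.symm) (e x) := by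
    apply MDifferentiableAt.comp (I' := 𝓡 n) _ _ hsymm
    rwa [e.left_inv hxe]
  have hex : MDifferentiableAt (𝓡 n) (𝓡 n) e x := mdifferentiableAt_extChartAt hx
  have h1 : mfderiv (𝓡 n) 𝓘(ℝ, ℝ) f x = (mfderiv (𝓡 n) 𝓘(ℝ, ℝ) (f ∘ e.symm) (e x)).comp
      (mfderiv (𝓡 n) (𝓡 n) e x) := by
    rw [← mfderiv_comp x hfe hex]
    apply Filter.EventuallyEq.mfderiv_eq
    filter_upwards [extChartAt_source_mem_nhds' (I := 𝓡 n) hxe] with z hz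
    simp [e.left_inv hz]
  have h2 : mfderiv (𝓡 n) (𝓡 n) e x v = (trivializationAt (EuclideanSpace ℝ (Fin n))
          (TangentSpace (𝓡 n)) x₁ ⟨x, v⟩).2 := by
    have h3 := DFunLike.congr_fun (TangentBundle.continuousLinearMapAt_trivializationAt hx) v
    refine h3.symm.trans ?_
    rw [Bundle.Trivialization.continuousLinearMapAt_apply, Bundle.Trivialization.linearMapAt_apply]
    exact if_pos (by simpa using hx)
  refine (DFunLike.congr_fun h1 v).trans ?_
  rw [← h2, ← mfderiv_eq_fderiv]
  rfl

variable {X}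

lemma continuousOn_trivialization_section
    (hX : ∀ i, ContMDiff 𝓘(ℝ, EuclideanSpace ℝ (Fin n))
      𝓘(ℝ, EuclideanSpace ℝ (Fin n)).tangent ∞
      (fun x => (⟨x, X i x⟩ : TangentBundle 𝓘(ℝ, EuclideanSpace ℝ (Fin n)) M)))
    (i : Fin m) (x₁ : M) :
    ContinuousOn (fun x => (trivializationAt (EuclideanSpace ℝ (Fin n))
          (TangentSpace 𝓘(ℝ, EuclideanSpace ℝ (Fin n))) x₁ ⟨x, X i x⟩).2)
      (chartAt (EuclideanSpace ℝ (Fin n)) x₁).source := by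
  have : IsManifold (𝓡 n) 1 M := IsManifold.of_le (n := ∞) (by norm_cast)
  intro x hx
  have hc := (hX i).continuous.continuousAt (x := x)
  have ht : ContinuousAt (trivializationAt (EuclideanSpace ℝ (Fin n))
          (TangentSpace 𝓘(ℝ, EuclideanSpace ℝ (Fin n))) x₁) ⟨x, X i x⟩ := by
    apply (trivializationAt (EuclideanSpace ℝ (Fin n))
          (TangentSpace 𝓘(ℝ, EuclideanSpace ℝ (Fin n))) x₁).continuousAt
    rw [Bundle.Trivialization.mem_source]
    simpa using hx
  exact (ContinuousAt.comp (f := fun x =>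
    (⟨x, X i x⟩ : TangentBundle 𝓘(ℝ, EuclideanSpace ℝ (Fin n)) M)) ht hc).snd.continuousWithinAt

lemma continuous_subgrad
    (hX : ∀ i, ContMDiff 𝓘(ℝ, EuclideanSpace ℝ (Fin n))
      𝓘(ℝ, EuclideanSpace ℝ (Fin n)).tangent ∞
      (fun x => (⟨x, X i x⟩ : TangentBundle 𝓘(ℝ, EuclideanSpace ℝ (Fin n)) M)))
    {f : M → ℝ} (hf : ContMDiff 𝓘(ℝ, EuclideanSpace ℝ (Fin n)) 𝓘(ℝ, ℝ) ∞ f) :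
    Continuous (subgrad X f) := by
  apply (PiLp.continuous_toLp 2 _).comp
  refine continuous_pi fun i => continuous_iff_continuousAt.2 fun x₁ => ?_
  have hs : (chartAt (EuclideanSpace ℝ (Fin n)) x₁).source ∈ 𝓝 x₁ := chart_source_mem_nhds _ _
  refine ContinuousOn.continuousAt ?_ hs
  have h2 : ContinuousOn (fun x => fderiv ℝ (f ∘ (extChartAt 𝓘(ℝ, EuclideanSpace ℝ (Fin n)) x₁).symm)
        (extChartAt 𝓘(ℝ, EuclideanSpace ℝ (Fin n)) x₁ x)
        ((trivializationAt (EuclideanSpace ℝ (Fin n))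
          (TangentSpace 𝓘(ℝ, EuclideanSpace ℝ (Fin n))) x₁ ⟨x, X i x⟩).2))
      (chartAt (EuclideanSpace ℝ (Fin n)) x₁).source := by
    refine ContinuousOn.clm_apply ?_ (continuousOn_trivialization_section hX i x₁)
    have h3 : ContDiffOn ℝ ∞ (f ∘ (extChartAt 𝓘(ℝ, EuclideanSpace ℝ (Fin n)) x₁).symm)
        (extChartAt 𝓘(ℝ, EuclideanSpace ℝ (Fin n)) x₁).target := by
      rw [← contMDiffOn_iff_contDiffOn]
      exact hf.comp_contMDiffOn (contMDiffOn_extChartAt_symm x₁)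
    have h4 := h3.continuousOn_fderiv_of_isOpen (isOpen_extChartAt_target x₁)
      (by norm_cast)
    refine h4.comp ?_ ?_
    · have := continuousOn_extChartAt (I := 𝓘(ℝ, EuclideanSpace ℝ (Fin n))) x₁
      rwa [extChartAt_source] at this
    · intro x hx
      apply (extChartAt 𝓘(ℝ, EuclideanSpace ℝ (Fin n)) x₁).map_source
      rwa [extChartAt_source]
  refine h2.congr fun x hx => ?_
  exact mfderiv_apply_eq_fderiv_chart hx (hf.mdifferentiableAt (by simp)) (X i x)

variable [MeasurableSpace M] [BorelSpace M] [SecondCountableTopology M] {lam : Measure M}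

/-- Countably many charts cover $M$. In a chart, the derivative in a constant direction is
measurable for an arbitrary function, whatever its values off the chart's target; the field is
therefore expanded in the standard basis. -/
lemma aemeasurable_subgrad
    (hX : ∀ i, ContMDiff 𝓘(ℝ, EuclideanSpace ℝ (Fin n))
      𝓘(ℝ, EuclideanSpace ℝ (Fin n)).tangent ∞
      (fun x => (⟨x, X i x⟩ : TangentBundle 𝓘(ℝ, EuclideanSpace ℝ (Fin n)) M)))
    {f : M → ℝ}
    (hf : ∀ᵐ x ∂lam, MDifferentiableAt 𝓘(ℝ, EuclideanSpace ℝ (Fin n)) 𝓘(ℝ, ℝ) f x) :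
    AEMeasurable (subgrad X f) lam := by
  have hmeas : Measurable (WithLp.toLp 2 : (Fin m → ℝ) → EuclideanSpace ℝ (Fin m)) :=
    (PiLp.continuous_toLp 2 _).measurable
  refine hmeas.comp_aemeasurable (aemeasurable_pi_iff.2 fun i => ?_)
  obtain ⟨s, hsc, hs⟩ := TopologicalSpace.countable_cover_nhds
    (fun x : M => chart_source_mem_nhds (EuclideanSpace ℝ (Fin n)) x)
  have := hsc.to_subtype
  have hcov : (⋃ y : s, (chartAt (EuclideanSpace ℝ (Fin n)) (y : M)).source) = univ := by
    rw [← hs, biUnion_eq_iUnion]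
  change AEMeasurable (fun x => (mfderiv 𝓘(ℝ, EuclideanSpace ℝ (Fin n)) 𝓘(ℝ, ℝ) f x (X i x) : ℝ)) lam
  rw [← Measure.restrict_univ (μ := lam), ← hcov]
  refine aemeasurable_iUnion_iff.2 ?_
  rintro ⟨x₁, -⟩
  have hopen := (chartAt (EuclideanSpace ℝ (Fin n)) x₁).open_source
  have hmc : AEMeasurable (extChartAt 𝓘(ℝ, EuclideanSpace ℝ (Fin n)) x₁)
      (lam.restrict (chartAt (EuclideanSpace ℝ (Fin n)) x₁).source) := by
    have := continuousOn_extChartAt (I := 𝓘(ℝ, EuclideanSpace ℝ (Fin n))) x₁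
    rw [extChartAt_source] at this
    exact this.aemeasurable hopen.measurableSet
  have h1 : AEMeasurable (fun x =>
      fderiv ℝ (f ∘ (extChartAt 𝓘(ℝ, EuclideanSpace ℝ (Fin n)) x₁).symm)
        (extChartAt 𝓘(ℝ, EuclideanSpace ℝ (Fin n)) x₁ x)
        ((trivializationAt (EuclideanSpace ℝ (Fin n))
          (TangentSpace 𝓘(ℝ, EuclideanSpace ℝ (Fin n))) x₁ ⟨x, X i x⟩).2))
      (lam.restrict (chartAt (EuclideanSpace ℝ (Fin n)) x₁).source) := by
    have hb := (continuousOn_trivialization_section hX i x₁).aemeasurable (μ := lam)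
      hopen.measurableSet
    set T : M → EuclideanSpace ℝ (Fin n) := fun x => (trivializationAt (EuclideanSpace ℝ (Fin n))
          (TangentSpace 𝓘(ℝ, EuclideanSpace ℝ (Fin n))) x₁ ⟨x, X i x⟩).2
    have hsum : ∀ x, fderiv ℝ (f ∘ (extChartAt 𝓘(ℝ, EuclideanSpace ℝ (Fin n)) x₁).symm)
        (extChartAt 𝓘(ℝ, EuclideanSpace ℝ (Fin n)) x₁ x) (T x) =
        ∑ j, T x j * fderiv ℝ (f ∘ (extChartAt 𝓘(ℝ, EuclideanSpace ℝ (Fin n)) x₁).symm)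
          (extChartAt 𝓘(ℝ, EuclideanSpace ℝ (Fin n)) x₁ x) (EuclideanSpace.single j 1) := by
      intro x
      conv_lhs => rw [← (EuclideanSpace.basisFun (Fin n) ℝ).sum_repr (T x)]
      simp
    change AEMeasurable (fun x => fderiv ℝ (f ∘ (extChartAt 𝓘(ℝ, EuclideanSpace ℝ (Fin n)) x₁).symm)
        (extChartAt 𝓘(ℝ, EuclideanSpace ℝ (Fin n)) x₁ x) (T x)) _
    rw [funext hsum]
    refine Finset.aemeasurable_fun_sum _ fun j _ => AEMeasurable.mul ?_ ?_
    · exact (EuclideanSpace.proj (𝕜 := ℝ) j).continuous.measurable.comp_aemeasurable hb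
    · exact (measurable_fderiv_apply_const ℝ _ _).comp_aemeasurable hmc
  refine h1.congr ?_
  filter_upwards [ae_restrict_of_ae hf, ae_restrict_mem hopen.measurableSet] with x hfx hx
  exact (mfderiv_apply_eq_fderiv_chart hx hfx (X i x)).symm

end Calculus

/-! ### Locally Lipschitz test functions, and local finiteness of volume measures. -/

/-- Locally Lipschitz functions that are differentiable almost everywhere. -/
def LipDiff (n : ℕ) {M : Type*} [MetricSpace M] [ChartedSpace (EuclideanSpace ℝ (Fin n)) M]
    [MeasurableSpace M] (ν : Measure M) (f : M → ℝ) : Prop :=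
  LocallyLipschitz f ∧ ∀ᵐ x ∂ν, MDifferentiableAt (𝓡 n) 𝓘(ℝ, ℝ) f x

lemma LocallyLipschitz.comp_contDiffAt {M : Type*} [PseudoEMetricSpace M] {f : M → ℝ} {Φ : ℝ → ℝ}
    (hf : LocallyLipschitz f) (hΦ : ∀ x, ContDiffAt ℝ 1 Φ (f x)) :
    LocallyLipschitz fun x => Φ (f x) := by
  intro x
  obtain ⟨K, t, ht, hK⟩ := hf x
  obtain ⟨K', t', ht', hK'⟩ := (hΦ x).exists_lipschitzOnWith
  refine ⟨K' * K, t ∩ f ⁻¹' t', inter_mem ht (hf.continuous.continuousAt ht'), ?_⟩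
  exact hK'.comp (hK.mono inter_subset_left) fun y hy => hy.2

section

variable {n : ℕ} {M : Type*} [MetricSpace M] [ChartedSpace (EuclideanSpace ℝ (Fin n)) M]
    [MeasurableSpace M] {ν : Measure M} {f g : M → ℝ}

lemma LipDiff.isTestFunction (hf : LipDiff n ν f) : IsTestFunction n ν f :=
  ⟨Or.inr hf.1, hf.2⟩

lemma LipDiff.continuous (hf : LipDiff n ν f) : Continuous f := hf.1.continuous

lemma LipDiff.comp {Φ : ℝ → ℝ} (hf : LipDiff n ν f) (hΦ : ∀ x, ContDiffAt ℝ 1 Φ (f x)) :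
    LipDiff n ν fun x => Φ (f x) := by
  refine ⟨hf.1.comp_contDiffAt hΦ, ?_⟩
  filter_upwards [hf.2] with x hx
  exact hx.comp_real ((hΦ x).differentiableAt one_ne_zero)

lemma LipDiff.mul (hf : LipDiff n ν f) (hg : LipDiff n ν g) :
    LipDiff n ν fun x => f x * g x := by
  refine ⟨?_, ?_⟩
  · exact ((contDiff_fst.mul contDiff_snd : ContDiff ℝ 1
      fun z : ℝ × ℝ => z.1 * z.2).locallyLipschitz).comp (hf.1.prodMk hg.1)
  · filter_upwards [hf.2, hg.2] with x hx hy
    exact (hx.hasMFDerivAt.mul hy.hasMFDerivAt).mdifferentiableAt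

lemma LipDiff.add (hf : LipDiff n ν f) (hg : LipDiff n ν g) :
    LipDiff n ν fun x => f x + g x := by
  refine ⟨?_, ?_⟩
  · exact ((contDiff_fst.add contDiff_snd : ContDiff ℝ 1
      fun z : ℝ × ℝ => z.1 + z.2).locallyLipschitz).comp (hf.1.prodMk hg.1)
  · filter_upwards [hf.2, hg.2] with x hx hy
    exact (hx.hasMFDerivAt.add hy.hasMFDerivAt).mdifferentiableAt

lemma LipDiff.mono_ae {ν' : Measure M} (h : ν ≪ ν') (hf : LipDiff n ν' f) : LipDiff n ν f :=
  ⟨hf.1, h.ae_le hf.2⟩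

variable {m : ℕ} {X : Fin m → (x : M) → TangentSpace (𝓡 n) x} {L : ℝ≥0}

lemma dist_le_of_norm_subgrad_le (hL : ∀ x y : M, intrinsicEDist X ν x y ≤ L * edist x y)
    (hf : IsTestFunction n ν f) {C : ℝ} (hC : 0 < C) (h : ∀ᵐ x ∂ν, ‖subgrad X f x‖ ≤ C) (x y : M) :
    dist (f x) (f y) ≤ C * L * dist x y := by
  have hd : ∀ t : ℝ, HasDerivAt (fun t : ℝ => C⁻¹ * t) C⁻¹ t := fun t => by
    simpa using (hasDerivAt_id t).const_mul C⁻¹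
  have hcd : ContDiff ℝ 1 (fun t : ℝ => C⁻¹ * t) := contDiff_const.mul contDiff_id
  have htest : IsTestFunction n ν fun x => C⁻¹ * f x := by
    refine ⟨?_, ?_⟩
    · rcases hf.1 with h1 | h1
      · left
        exact (contMDiff_const (c := C⁻¹)).mul h1
      · right
        exact h1.comp_contDiffAt fun x => hcd.contDiffAt
    · filter_upwards [hf.2] with x hx
      exact hx.comp_real (hd _).differentiableAt
  have hle : ∀ᵐ z ∂ν, ‖subgrad X (fun x => C⁻¹ * f x) z‖ ≤ 1 := by
    filter_upwards [hf.2, h] with z hz hz2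
    rw [subgrad_comp X hz (hd _), norm_smul, Real.norm_eq_abs, abs_of_pos (inv_pos.2 hC)]
    rw [inv_mul_le_iff₀ hC]
    simpa using hz2
  have h1 : edist (C⁻¹ * f x) (C⁻¹ * f y) ≤ L * edist x y :=
    le_trans (le_iSup₂_of_le (f := fun (φ : M → ℝ) (_ : IsTestFunction n ν φ) =>
      ⨆ (_ : ∀ᵐ z ∂ν, ‖subgrad X φ z‖ ≤ 1), edist (φ x) (φ y)) _ htest
      (le_iSup_of_le hle le_rfl)) (hL x y)
  rw [edist_dist, edist_dist, ← ENNReal.ofReal_coe_nnreal, ← ENNReal.ofReal_mul L.coe_nonneg,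
    ENNReal.ofReal_le_ofReal_iff (by positivity)] at h1
  rw [Real.dist_eq, ← mul_sub, abs_mul, abs_of_pos (inv_pos.2 hC), inv_mul_le_iff₀ hC] at h1
  rw [Real.dist_eq]
  linarith

/-- Multiplied by a bump function, $f$ has a continuous, compactly supported, hence bounded
subgradient. Comparison with the intrinsic distance makes the product globally Lipschitz, and it
equals $f$ near the centre. Both kinds of test function thus become one. -/
lemma locallyLipschitz_of_contMDiff [IsManifold (𝓡 n) ∞ M]
    (hX : ∀ i, ContMDiff (𝓡 n) (𝓡 n).tangent ∞
      (fun x => (⟨x, X i x⟩ : TangentBundle (𝓡 n) M)))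
    (hL : ∀ x y : M, intrinsicEDist X ν x y ≤ L * edist x y)
    (hf : ContMDiff (𝓡 n) 𝓘(ℝ, ℝ) ∞ f) : LocallyLipschitz f := by
  intro x
  let b : SmoothBumpFunction (𝓡 n) x := Classical.choice inferInstance
  have hb : ContMDiff (𝓡 n) 𝓘(ℝ, ℝ) ∞ fun y => b y * f y := b.contMDiff.mul hf
  have hsupp : HasCompactSupport fun y => b y * f y := b.hasCompactSupport.mul_right
  have hg : Continuous fun y => ‖subgrad X (fun y => b y * f y) y‖ :=
    (continuous_subgrad hX hb).norm
  have hgs : HasCompactSupport fun y => ‖subgrad X (fun y => b y * f y) y‖ := by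
    refine HasCompactSupport.intro hsupp fun y hy => ?_
    have h0 : (fun y => b y * f y) =ᶠ[𝓝 y] fun _ => (0 : ℝ) := notMem_tsupport_iff_eventuallyEq.1 hy
    rw [norm_eq_zero]
    ext i
    change mfderiv _ _ _ y (X i y) = 0
    rw [h0.mfderiv_eq, mfderiv_const]
    rfl
  obtain ⟨C, hC⟩ := hgs.exists_bound_of_continuous hg
  have hC' : ∀ᵐ y ∂ν, ‖subgrad X (fun y => b y * f y) y‖ ≤ |C| + 1 := by
    refine Eventually.of_forall fun y => ?_
    have := hC y
    rw [norm_norm] at this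
    linarith [le_abs_self C]
  have hlip := dist_le_of_norm_subgrad_le hL
    ⟨Or.inl hb, Eventually.of_forall fun y => hb.mdifferentiableAt (by simp)⟩
    (by positivity) hC'
  refine ⟨Real.toNNReal (|C| + 1) * L, {y | b y = 1}, b.eventuallyEq_one, ?_⟩
  refine LipschitzOnWith.of_dist_le_mul fun y hy z hz => ?_
  have := hlip y z
  simp only [mem_ofPred_eq] at hy hz
  rw [hy, hz, one_mul, one_mul] at this
  rw [NNReal.coe_mul, Real.coe_toNNReal _ (by positivity)]
  exact this

lemma IsTestFunction.lipDiff [IsManifold (𝓡 n) ∞ M]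
    (hX : ∀ i, ContMDiff (𝓡 n) (𝓡 n).tangent ∞
      (fun x => (⟨x, X i x⟩ : TangentBundle (𝓡 n) M)))
    (hL : ∀ x y : M, intrinsicEDist X ν x y ≤ L * edist x y)
    {ν' : Measure M} (hf : IsTestFunction n ν' f) : LipDiff n ν' f :=
  ⟨hf.1.elim (locallyLipschitz_of_contMDiff hX hL) id, hf.2⟩

/-- The continuous density is bounded on a small compact ball inside a chart. -/
lemma IsVolume.isLocallyFiniteMeasure [BorelSpace M] (h : IsVolume n ν) :
    IsLocallyFiniteMeasure ν := by
  refine ⟨fun x => ?_⟩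
  set e := chartAt (EuclideanSpace ℝ (Fin n)) x
  obtain ⟨ρ, hρ, -, hν⟩ := h e (chart_mem_atlas _ x)
  obtain ⟨r, hr, hball⟩ := Metric.nhds_basis_closedBall.mem_iff.1
    (e.open_target.mem_nhds (e.map_source (mem_chart_source _ x)))
  obtain ⟨C, hC⟩ := (isCompact_closedBall (e x) r).exists_bound_of_continuousOn (hρ.mono hball)
  have hopen : IsOpen (e.source ∩ e ⁻¹' Metric.ball (e x) r) :=
    e.isOpen_inter_preimage Metric.isOpen_ball
  refine ⟨e.source ∩ e ⁻¹' Metric.ball (e x) r, hopen.mem_nhds ⟨mem_chart_source _ x, by simpa⟩, ?_⟩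
  rw [hν _ hopen.measurableSet inter_subset_left]
  have hsub : e '' (e.source ∩ e ⁻¹' Metric.ball (e x) r) ⊆ Metric.closedBall (e x) r := by
    rintro _ ⟨y, hy, rfl⟩
    exact Metric.ball_subset_closedBall hy.2
  calc ∫⁻ y in e '' (e.source ∩ e ⁻¹' Metric.ball (e x) r), ENNReal.ofReal (ρ y)
      ≤ ∫⁻ y in Metric.closedBall (e x) r, ENNReal.ofReal (ρ y) := lintegral_mono_set hsub
    _ ≤ ∫⁻ y in Metric.closedBall (e x) r, ENNReal.ofReal C := by
        refine setLIntegral_mono measurable_const fun y hy => ENNReal.ofReal_le_ofReal ?_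
        exact (le_abs_self _).trans (hC y hy)
    _ < ⊤ := by
        rw [setLIntegral_const]
        exact ENNReal.mul_lt_top ENNReal.ofReal_lt_top measure_closedBall_lt_top

end

/-! ### Integration tools and the smooth cut-off. -/

section Lintegral

variable {α : Type*} [MeasurableSpace α] {μ : Measure α}

lemma lintegral_ofReal_const_mul {c : ℝ} (hc : 0 ≤ c) (f : α → ℝ) :
    ∫⁻ x, ENNReal.ofReal (c * f x) ∂μ = ENNReal.ofReal c * ∫⁻ x, ENNReal.ofReal (f x) ∂μ := by
  simp_rw [ENNReal.ofReal_mul hc]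
  exact lintegral_const_mul' _ _ ENNReal.ofReal_ne_top

lemma lintegral_ofReal_le_add {a f g : α → ℝ} (hf : AEMeasurable f μ)
    (h : ∀ᵐ x ∂μ, a x ≤ f x + g x) :
    ∫⁻ x, ENNReal.ofReal (a x) ∂μ ≤
      ∫⁻ x, ENNReal.ofReal (f x) ∂μ + ∫⁻ x, ENNReal.ofReal (g x) ∂μ := by
  rw [← lintegral_add_left' hf.ennreal_ofReal]
  refine lintegral_mono_ae ?_
  filter_upwards [h] with x hx
  exact (ENNReal.ofReal_le_ofReal hx).trans ENNReal.ofReal_add_le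

lemma lintegral_ofReal_le_mul_add {a f g : α → ℝ} {c k : ℝ} (hc : 0 ≤ c) (hk : 0 ≤ k)
    (hf : AEMeasurable f μ) (h : ∀ᵐ x ∂μ, a x ≤ c * f x + k * g x) :
    ∫⁻ x, ENNReal.ofReal (a x) ∂μ ≤ ENNReal.ofReal c * ∫⁻ x, ENNReal.ofReal (f x) ∂μ +
      ENNReal.ofReal k * ∫⁻ x, ENNReal.ofReal (g x) ∂μ := by
  rw [← lintegral_ofReal_const_mul hc, ← lintegral_ofReal_const_mul hk]
  exact lintegral_ofReal_le_add (hf.const_mul c) h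

/-- Fatou's lemma, in the form that removes cut-offs from uniform bounds. -/
lemma lintegral_ofReal_le_of_tendsto {F : ℕ → α → ℝ} {f : α → ℝ} {B : ℝ≥0∞}
    (hF : ∀ j, AEMeasurable (F j) μ) (hlim : ∀ x, Tendsto (fun j => F j x) atTop (𝓝 (f x)))
    (hB : ∀ j, ∫⁻ x, ENNReal.ofReal (F j x) ∂μ ≤ B) :
    ∫⁻ x, ENNReal.ofReal (f x) ∂μ ≤ B := by
  have h1 : ∀ x, ENNReal.ofReal (f x) = liminf (fun j => ENNReal.ofReal (F j x)) atTop :=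
    fun x => (ENNReal.tendsto_ofReal (hlim x)).liminf_eq.symm
  simp_rw [h1]
  refine (lintegral_liminf_le' fun j => (hF j).ennreal_ofReal).trans ?_
  exact (liminf_le_liminf (Eventually.of_forall hB)).trans (by simp)

lemma lintegral_ofReal_le_of_eventually_eq {F : ℕ → α → ℝ} {f : α → ℝ} {B : ℝ≥0∞}
    (hF : ∀ j, AEMeasurable (F j) μ) (hlim : ∀ x, ∀ᶠ j in atTop, F j x = f x)
    (hB : ∀ j, ∫⁻ x, ENNReal.ofReal (F j x) ∂μ ≤ B) :
    ∫⁻ x, ENNReal.ofReal (f x) ∂μ ≤ B :=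
  lintegral_ofReal_le_of_tendsto hF
    (fun x => tendsto_const_nhds.congr' ((hlim x).mono fun _ hj => hj.symm)) hB

end Lintegral

lemma deriv_smoothTransition_eq_zero {t : ℝ} (ht : 1 < t) : deriv Real.smoothTransition t = 0 := by
  have : Real.smoothTransition =ᶠ[𝓝 t] fun _ => 1 := by
    filter_upwards [Ioi_mem_nhds ht] with s hs
    exact Real.smoothTransition.one_of_one_le (le_of_lt hs)
  rw [this.deriv_eq, deriv_const]

lemma exists_deriv_smoothTransition_le :
    ∃ C : ℝ, 0 < C ∧ ∀ t : ℝ, |deriv Real.smoothTransition t| ≤ C := by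
  have hc : Continuous (deriv Real.smoothTransition) :=
    (Real.smoothTransition.contDiff (n := 1)).continuous_deriv le_rfl
  have hs : HasCompactSupport (deriv Real.smoothTransition) := by
    refine HasCompactSupport.intro (isCompact_Icc (a := (0 : ℝ)) (b := 1)) fun t ht => ?_
    rw [mem_Icc, not_and_or, not_le, not_le] at ht
    rcases ht with ht | ht
    · have : Real.smoothTransition =ᶠ[𝓝 t] fun _ => 0 := by
        filter_upwards [Iio_mem_nhds ht] with s hs
        exact Real.smoothTransition.zero_of_nonpos (le_of_lt hs)
      rw [this.deriv_eq, deriv_const]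
    · exact deriv_smoothTransition_eq_zero ht
  obtain ⟨C, hC⟩ := hs.exists_bound_of_continuous hc
  exact ⟨|C| + 1, by positivity, fun t => (hC t).trans (by linarith [le_abs_self C])⟩

lemma hasDerivAt_smoothTransition (t : ℝ) :
    HasDerivAt Real.smoothTransition (deriv Real.smoothTransition t) t :=
  ((Real.smoothTransition.contDiff (n := 1)).differentiable one_ne_zero t).hasDerivAt

/-! ### Confining potentials, U-bounds and the global Sobolev inequality. -/

/-- A potential `U` whose gradient is comparable with `d ^ r` in the radial direction, on a space
where the distance `d` from `x₀` has a Laplacian bounded above. -/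
structure Confining {n m : ℕ} {M : Type*} [MetricSpace M]
    [ChartedSpace (EuclideanSpace ℝ (Fin n)) M] [MeasurableSpace M]
    (X : Fin m → (x : M) → TangentSpace (𝓡 n) x) (ν : Measure M) (x₀ : M) (U : M → ℝ) (r : ℝ) :
    Prop where
  meas : ∀ f : M → ℝ, LipDiff n ν f → AEMeasurable (subgrad X f) ν
  pos : 0 < r
  lt_one : r < 1
  dist_lipDiff : LipDiff n ν fun y => dist x₀ y
  dist_le : ∀ᵐ x ∂ν, ‖subgrad X (fun y => dist x₀ y) x‖ ≤ 1
  lap : ∃ K : ℝ, 0 < K ∧ LaplacianLEOn X ν (fun y => dist x₀ y) {x | 1 < dist x₀ x} K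
  pot : LipDiff n ν U
  drift : ∃ c γ : ℝ, 0 < c ∧ 0 < γ ∧ ∀ᵐ x ∂ν,
    c * dist x₀ x ^ r - γ ≤ inner ℝ (subgrad X (fun y => dist x₀ y) x) (subgrad X U x)
  growth : ∃ A : ℝ, 0 < A ∧ ∀ᵐ x ∂ν, ‖subgrad X U x‖ ≤ A * (1 + dist x₀ x ^ r)
  pot_le : ∃ A : ℝ, 0 < A ∧ ∀ x, U x ≤ A * (1 + dist x₀ x ^ (r + 1))

/-- The measure with density `e^{-U}`. -/
noncomputable def gibbs {M : Type*} [MeasurableSpace M] (ν : Measure M) (U : M → ℝ) : Measure M :=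
  ν.withDensity fun x => ENNReal.ofReal (Real.exp (-U x))

section

variable {n m : ℕ} {M : Type*} [MetricSpace M] [ChartedSpace (EuclideanSpace ℝ (Fin n)) M]
    [MeasurableSpace M] {ν : Measure M} {X : Fin m → (x : M) → TangentSpace (𝓡 n) x}
    {x₀ : M} {U : M → ℝ} {r : ℝ}

omit [MetricSpace M] in
lemma gibbs_absolutelyContinuous : gibbs ν U ≪ ν := withDensity_absolutelyContinuous _ _

variable [BorelSpace M]

lemma lintegral_gibbs (hU : Continuous U) (F : M → ℝ≥0∞) :
    ∫⁻ x, F x ∂(gibbs ν U) = ∫⁻ x, ENNReal.ofReal (Real.exp (-U x)) * F x ∂ν := by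
  rw [gibbs, lintegral_withDensity_eq_lintegral_mul_non_measurable _ (by fun_prop)
    (Eventually.of_forall fun x => ENNReal.ofReal_lt_top)]
  rfl

lemma lintegral_ofReal_gibbs (hU : Continuous U) (F : M → ℝ) :
    ∫⁻ x, ENNReal.ofReal (F x) ∂(gibbs ν U) =
      ∫⁻ x, ENNReal.ofReal (Real.exp (-U x) * F x) ∂ν := by
  rw [lintegral_gibbs hU]
  simp_rw [ENNReal.ofReal_mul (Real.exp_nonneg _)]

lemma absolutelyContinuous_gibbs (hU : Continuous U) : ν ≪ gibbs ν U :=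
  withDensity_absolutelyContinuous' (by fun_prop)
    (Eventually.of_forall fun x => by simpa using Real.exp_pos _)

namespace Confining

variable (h : Confining X ν x₀ U r)
include h

omit [BorelSpace M] in
lemma continuous_dist_rpow : Continuous fun x : M => dist x₀ x ^ r :=
  (continuous_const.dist continuous_id).rpow_const fun _ => Or.inr h.pos.le

/-- Test $\Delta d\le K$ with $\psi e^{-U}$: in $-\nabla d\cdot\nabla(\psi
e^{-U})=e^{-U}(\psi\,\nabla d\cdot\nabla U-\nabla d\cdot\nabla\psi)$ the drift bounds the first term
below, and $|\nabla d|\le1$ the second. -/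
lemma lintegral_mul_dist_rpow_le_of_compact [ProperSpace M] [IsFiniteMeasureOnCompacts ν]
    {c γ K : ℝ} (hc : 0 < c) (hγ : 0 < γ) (hK : 0 < K)
    (hdrift : ∀ᵐ x ∂ν, c * dist x₀ x ^ r - γ ≤
      inner ℝ (subgrad X (fun y => dist x₀ y) x) (subgrad X U x))
    (hlap : LaplacianLEOn X ν (fun y => dist x₀ y) {x | 1 < dist x₀ x} K)
    {ψ : M → ℝ} (hψ : LipDiff n ν ψ) (hψc : HasCompactSupport ψ)
    (hψs : tsupport ψ ⊆ {x | 1 < dist x₀ x}) (hψ0 : ∀ x, 0 ≤ ψ x) :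
    ENNReal.ofReal c * ∫⁻ x, ENNReal.ofReal (ψ x * dist x₀ x ^ r) ∂(gibbs ν U) ≤
      ENNReal.ofReal (K + γ) * ∫⁻ x, ENNReal.ofReal (ψ x) ∂(gibbs ν U) +
        ∫⁻ x, ENNReal.ofReal ‖subgrad X ψ x‖ ∂(gibbs ν U) := by
  have hUc := h.pot.continuous
  -- If the gradient term is infinite there is nothing to prove. If it is finite, $\nabla
  -- d\cdot\nabla(\psi e^{-U})$ is integrable, as the weak form of the Laplacian bound requires.
  by_cases htop : ∫⁻ x, ENNReal.ofReal ‖subgrad X ψ x‖ ∂(gibbs ν U) = ⊤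
  · rw [htop]; simp
  rw [lintegral_ofReal_gibbs hUc] at htop
  rw [lintegral_ofReal_gibbs hUc, lintegral_ofReal_gibbs hUc, lintegral_ofReal_gibbs hUc]
  have hψcont := hψ.continuous
  have hdc := h.continuous_dist_rpow
  have hI1 : Integrable (fun x => Real.exp (-U x) * (ψ x * dist x₀ x ^ r)) ν := by
    apply Continuous.integrable_of_hasCompactSupport (by fun_prop)
    exact (hψc.mul_right).mul_left
  have hI2 : Integrable (fun x => Real.exp (-U x) * ψ x) ν := by
    apply Continuous.integrable_of_hasCompactSupport (by fun_prop)
    exact hψc.mul_left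
  have hmψ := h.meas ψ hψ
  have hI3 : Integrable (fun x => Real.exp (-U x) * ‖subgrad X ψ x‖) ν := by
    have hm : AEMeasurable (fun x => Real.exp (-U x) * ‖subgrad X ψ x‖) ν :=
      AEMeasurable.mul (by fun_prop) hmψ.norm
    refine ⟨hm.aestronglyMeasurable, ?_⟩
    rw [hasFiniteIntegral_iff_ofReal (Eventually.of_forall fun x => by positivity)]
    exact lt_of_le_of_ne le_top htop
  have hφ : LipDiff n ν fun x => ψ x * Real.exp (-U x) :=
    hψ.mul (h.pot.comp (Φ := fun t => Real.exp (-t)) fun x => by fun_prop)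
  have hexp : ∀ t : ℝ, HasDerivAt (fun t => Real.exp (-t)) (-Real.exp (-t)) t := fun t => by
    simpa using (hasDerivAt_neg t).exp
  have hgrad : ∀ᵐ x ∂ν, subgrad X (fun x => ψ x * Real.exp (-U x)) x =
      ψ x • (-Real.exp (-U x)) • subgrad X U x + Real.exp (-U x) • subgrad X ψ x := by
    filter_upwards [hψ.2, h.pot.2] with x h1 h2
    rw [subgrad_mul X h1 (h2.comp_real (Φ := fun t => Real.exp (-t)) (hexp _).differentiableAt),
      subgrad_comp X h2 (hexp _)]
  obtain ⟨A, hA, hgrow⟩ := h.growth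
  have hint : Integrable (fun x => inner ℝ (subgrad X (fun y => dist x₀ y) x)
      (subgrad X (fun x => ψ x * Real.exp (-U x)) x)) ν := by
    refine Integrable.mono' (((hI1.add hI2).const_mul A).add hI3) ?_ ?_
    · exact ((h.meas _ h.dist_lipDiff).inner (h.meas _ hφ)).aestronglyMeasurable
    · filter_upwards [hgrad, hgrow, h.dist_le] with x h1 h2 h3
      refine (norm_inner_le_norm _ _).trans ?_
      rw [h1]
      calc _ ≤ 1 * (ψ x * (Real.exp (-U x) * ‖subgrad X U x‖)
            + Real.exp (-U x) * ‖subgrad X ψ x‖) := by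
            gcongr
            refine (norm_add_le _ _).trans (le_of_eq ?_)
            rw [norm_smul, norm_smul, norm_smul, norm_neg, Real.norm_of_nonneg (hψ0 x),
              Real.norm_of_nonneg (Real.exp_nonneg _)]
        _ ≤ ψ x * (Real.exp (-U x) * (A * (1 + dist x₀ x ^ r)))
            + Real.exp (-U x) * ‖subgrad X ψ x‖ := by
            rw [one_mul]
            have := hψ0 x
            gcongr
        _ = _ := by simp only [Pi.add_apply]; ring
  have hφc : HasCompactSupport fun x => ψ x * Real.exp (-U x) := hψc.mul_right
  have key := hlap _ hφ.isTestFunction hφc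
    ((closure_mono (Function.support_mul_subset_left _ _)).trans hψs)
    (fun x => mul_nonneg (hψ0 x) (Real.exp_nonneg _)) hint
  have hlow : c * (∫ x, Real.exp (-U x) * (ψ x * dist x₀ x ^ r) ∂ν)
      - γ * (∫ x, Real.exp (-U x) * ψ x ∂ν) - ∫ x, Real.exp (-U x) * ‖subgrad X ψ x‖ ∂ν ≤
      -(∫ x, inner ℝ (subgrad X (fun y => dist x₀ y) x)
      (subgrad X (fun x => ψ x * Real.exp (-U x)) x) ∂ν) := by
    have hI12 : Integrable (fun x => c * (Real.exp (-U x) * (ψ x * dist x₀ x ^ r)) -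
      γ * (Real.exp (-U x) * ψ x)) ν := (hI1.const_mul c).sub (hI2.const_mul γ)
    rw [← integral_const_mul, ← integral_const_mul, ← integral_neg, ← integral_sub
      (hI1.const_mul _) (hI2.const_mul _), ← integral_sub hI12 hI3]
    refine integral_mono_ae (hI12.sub hI3) hint.neg ?_
    filter_upwards [hgrad, hdrift, h.dist_le] with x h1 h2 h3
    simp only [h1, inner_add_right, inner_smul_right]
    have h4 : inner ℝ (subgrad X (fun y => dist x₀ y) x) (subgrad X ψ x) ≤ ‖subgrad X ψ x‖ := by
      refine (real_inner_le_norm _ _).trans ?_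
      nlinarith [norm_nonneg (subgrad X ψ x)]
    have h5 := mul_le_mul_of_nonneg_left h4 (Real.exp_nonneg (-U x))
    have h6 := mul_le_mul_of_nonneg_left h2 (mul_nonneg (hψ0 x) (Real.exp_nonneg (-U x)))
    nlinarith
  rw [show (∫ x, ψ x * Real.exp (-U x) ∂ν) = ∫ x, Real.exp (-U x) * ψ x ∂ν by
    simp_rw [mul_comm]] at key
  have hp1 : ∀ x, 0 ≤ Real.exp (-U x) * (ψ x * dist x₀ x ^ r) := fun x => by
    have := hψ0 x; positivity
  have hp2 : ∀ x, 0 ≤ Real.exp (-U x) * ψ x := fun x => by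
    have := hψ0 x; positivity
  have hp3 : ∀ x, 0 ≤ Real.exp (-U x) * ‖subgrad X ψ x‖ := fun x => by positivity
  rw [← ofReal_integral_eq_lintegral_ofReal hI1 (Eventually.of_forall hp1),
    ← ofReal_integral_eq_lintegral_ofReal hI2 (Eventually.of_forall hp2),
    ← ofReal_integral_eq_lintegral_ofReal hI3 (Eventually.of_forall hp3),
    ← ENNReal.ofReal_mul hc.le, ← ENNReal.ofReal_mul (by positivity),
    ← ENNReal.ofReal_add (mul_nonneg (by positivity) (integral_nonneg hp2)) (integral_nonneg hp3)]
  apply ENNReal.ofReal_le_ofReal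
  linarith

end Confining
end

/-- Absorption of half of the left side. It fails for $I=\infty$, so each application must first
prove finiteness. -/
lemma ENNReal.le_mul_of_le_mul_add_half {I G : ℝ≥0∞} (hI : I ≠ ⊤) {a : ℝ}
    (h : I ≤ ENNReal.ofReal a * G + ENNReal.ofReal (1 / 2) * I) :
    I ≤ ENNReal.ofReal (2 * a) * G := by
  rw [ENNReal.ofReal_mul zero_le_two, mul_assoc]
  generalize ENNReal.ofReal a * G = Y at *
  by_cases hY : Y = ⊤
  · rw [hY]; simp
  lift I to ℝ≥0 using hI
  lift Y to ℝ≥0 using hY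
  rw [← ENNReal.toReal_le_toReal (by simp) (by finiteness)] at h ⊢
  rw [ENNReal.toReal_add (by finiteness) (by finiteness), ENNReal.toReal_mul,
    ENNReal.toReal_ofReal (by positivity)] at h
  rw [ENNReal.toReal_mul, ENNReal.toReal_ofReal (by positivity)]
  linarith

section

variable {n m : ℕ} {M : Type*} [MetricSpace M] [ChartedSpace (EuclideanSpace ℝ (Fin n)) M]
    [MeasurableSpace M] {ν : Measure M} {X : Fin m → (x : M) → TangentSpace (𝓡 n) x}
    {x₀ : M} {U : M → ℝ} {r : ℝ}

namespace Confining

variable (h : Confining X ν x₀ U r)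
include h

/-- Because $|\nabla d|\le1$, the gradient of a cut-off in $d$ is bounded by its slope, uniformly in
the radius. -/
lemma norm_subgrad_mul_dist_le {f : M → ℝ} (hf : LipDiff n ν f) {Φ : ℝ → ℝ}
    (hΦ : ContDiff ℝ 1 Φ) (hb : ∀ t, |Φ t| ≤ 1) {C : ℝ} (hC : ∀ t, |deriv Φ t| ≤ C) :
    LipDiff n ν (fun x => f x * Φ (dist x₀ x)) ∧
      ∀ᵐ x ∂ν, ‖subgrad X (fun x => f x * Φ (dist x₀ x)) x‖ ≤ C * |f x| + ‖subgrad X f x‖ := by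
  have hd := h.dist_lipDiff.comp (Φ := Φ) fun x => hΦ.contDiffAt
  refine ⟨hf.mul hd, ?_⟩
  filter_upwards [hf.2, h.dist_lipDiff.2, h.dist_le] with x h1 h2 h3
  have hder : HasDerivAt Φ (deriv Φ (dist x₀ x)) (dist x₀ x) :=
    (hΦ.differentiable one_ne_zero _).hasDerivAt
  rw [subgrad_mul X h1 (h2.comp_real hder.differentiableAt), subgrad_comp X h2 hder]
  refine (norm_add_le _ _).trans ?_
  rw [norm_smul, norm_smul, norm_smul, Real.norm_eq_abs, Real.norm_eq_abs, Real.norm_eq_abs]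
  have hC0 : 0 ≤ C := (abs_nonneg _).trans (hC 0)
  have e1 : |deriv Φ (dist x₀ x)| * ‖subgrad X (fun y => dist x₀ y) x‖ ≤ C * 1 :=
    mul_le_mul (hC _) h3 (norm_nonneg _) hC0
  have e2 := mul_le_mul_of_nonneg_left e1 (abs_nonneg (f x))
  have e3 := mul_le_mul_of_nonneg_right (hb (dist x₀ x)) (norm_nonneg (subgrad X f x))
  linarith

variable [BorelSpace M]

omit [BorelSpace M] in
lemma aemeasurable_subgrad_gibbs {f : M → ℝ} (hf : LipDiff n ν f) :
    AEMeasurable (subgrad X f) (gibbs ν U) :=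
  (h.meas f hf).mono_ac gibbs_absolutelyContinuous

/-- Cut off near $x_0$, where the Laplacian bound is unavailable, and at infinity, to have compact
support. Where $d\le3$ the weight is at most $3^r$, and the outer cut-off is removed by Fatou. -/
lemma lintegral_mul_dist_rpow_le [ProperSpace M] [IsFiniteMeasureOnCompacts ν] :
    ∃ C : ℝ, 0 < C ∧ ∀ g : M → ℝ, LipDiff n ν g → (∀ x, 0 ≤ g x) →
      ∫⁻ x, ENNReal.ofReal (g x * dist x₀ x ^ r) ∂(gibbs ν U) ≤
        ENNReal.ofReal C * ∫⁻ x, ENNReal.ofReal (‖subgrad X g x‖ + g x) ∂(gibbs ν U) := by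
  obtain ⟨c, γ, hc, hγ, hdrift⟩ := h.drift
  obtain ⟨K, hK, hlap⟩ := h.lap
  obtain ⟨S, hS, hSb⟩ := exists_deriv_smoothTransition_le
  -- `K + γ` comes from the Laplacian and the drift, `2 * S` from the slopes of the two cut-off
  -- factors, and `1` from $|\nabla g|$.
  set D : ℝ := K + γ + 2 * S + 1 with hD
  refine ⟨c⁻¹ * D + 3 ^ r, by positivity, fun g hg hg0 => ?_⟩
  have hgc := hg.continuous
  have hdc := h.continuous_dist_rpow
  set st := Real.smoothTransition
  have hstc : Continuous st := Real.smoothTransition.continuous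
  have hst1 : ∀ t, |st t| ≤ 1 := fun t => by
    rw [abs_of_nonneg (Real.smoothTransition.nonneg t)]; exact Real.smoothTransition.le_one t
  -- The weight vanishes for $t\le2$ and for $t\ge j$, and equals $1$ on $[3,j-1]$.
  let w : ℕ → ℝ → ℝ := fun j t => st (t - 2) * st (j - t)
  have hw : ∀ j, ContDiff ℝ 1 (w j) := fun j =>
    (Real.smoothTransition.contDiff.comp (contDiff_id.sub contDiff_const)).mul
      (Real.smoothTransition.contDiff.comp (contDiff_const.sub contDiff_id))
  have hw1 : ∀ j t, |w j t| ≤ 1 := fun j t => by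
    rw [abs_mul]; exact mul_le_one₀ (hst1 _) (abs_nonneg _) (hst1 _)
  have hw0 : ∀ j t, 0 ≤ w j t := fun j t =>
    mul_nonneg (Real.smoothTransition.nonneg _) (Real.smoothTransition.nonneg _)
  have hwd : ∀ j t, |deriv (w j) t| ≤ 2 * S := fun j t => by
    have h1 := (hasDerivAt_smoothTransition (t - 2)).comp_sub_const t 2
    have h2 := (hasDerivAt_smoothTransition (j - t)).comp_const_sub (j : ℝ) t
    rw [(h1.fun_mul h2).deriv, mul_neg]
    refine (abs_add_le _ _).trans ?_
    rw [abs_mul, abs_neg, abs_mul]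
    have e1 := mul_le_mul (hSb (t - 2)) (hst1 (j - t)) (abs_nonneg _) hS.le
    have e2 := mul_le_mul (hst1 (t - 2)) (hSb (j - t)) (abs_nonneg _) zero_le_one
    simp only [st] at e1 e2 ⊢
    linarith
  have hbound : ∀ j : ℕ, ∫⁻ x, ENNReal.ofReal (c * (g x * w j (dist x₀ x) * dist x₀ x ^ r))
      ∂(gibbs ν U) ≤
      ENNReal.ofReal D * ∫⁻ x, ENNReal.ofReal (‖subgrad X g x‖ + g x) ∂(gibbs ν U) := by
    intro j
    obtain ⟨hψ, hψg⟩ := h.norm_subgrad_mul_dist_le hg (hw j) (hw1 j) (hwd j)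
    have hsupp : Function.support (fun x => g x * w j (dist x₀ x)) ⊆
        {x | 2 ≤ dist x₀ x} ∩ Metric.closedBall x₀ j := by
      intro x hx
      rw [Function.mem_support] at hx
      refine ⟨?_, ?_⟩
      · by_contra hlt
        apply hx
        have : st (dist x₀ x - 2) = 0 := Real.smoothTransition.zero_of_nonpos
          (by simp only [mem_ofPred_eq, not_le] at hlt; linarith)
        simp [w, this]
      · by_contra hlt
        apply hx
        have : st (j - dist x₀ x) = 0 := Real.smoothTransition.zero_of_nonpos
          (by rw [Metric.mem_closedBall, not_le, dist_comm] at hlt; linarith)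
        simp [w, this]
    have hcl : IsClosed {x : M | 2 ≤ dist x₀ x} :=
      isClosed_le continuous_const (continuous_const.dist continuous_id)
    have hts : tsupport (fun x => g x * w j (dist x₀ x)) ⊆
        {x | 2 ≤ dist x₀ x} ∩ Metric.closedBall x₀ j :=
      closure_minimal hsupp (hcl.inter Metric.isClosed_closedBall)
    have hcs : HasCompactSupport (fun x => g x * w j (dist x₀ x)) :=
      IsCompact.of_isClosed_subset (isCompact_closedBall x₀ j) (isClosed_tsupport _)
        (hts.trans inter_subset_right)
    have key := h.lintegral_mul_dist_rpow_le_of_compact hc hγ hK hdrift hlap hψ hcs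
      (fun x hx => lt_of_lt_of_le (b := (2 : ℝ)) one_lt_two (hts hx).1) fun x => mul_nonneg (hg0 x) (hw0 j _)
    rw [lintegral_ofReal_const_mul hc.le]
    refine key.trans ?_
    rw [← lintegral_ofReal_const_mul (by positivity), ← lintegral_ofReal_const_mul (by positivity),
      ← lintegral_add_left']
    · refine lintegral_mono_ae ?_
      filter_upwards [gibbs_absolutelyContinuous hψg] with x hx
      rw [← ENNReal.ofReal_add]
      · apply ENNReal.ofReal_le_ofReal
        have e1 : g x * w j (dist x₀ x) ≤ g x :=
          mul_le_of_le_one_right (hg0 x) ((le_abs_self _).trans (hw1 j _))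
        have e2 := mul_le_mul_of_nonneg_left e1 (by positivity : 0 ≤ K + γ)
        rw [abs_of_nonneg (hg0 x)] at hx
        have e3 := norm_nonneg (subgrad X g x)
        have e4 := hg0 x
        have e5 : 0 ≤ (K + γ + 2 * S) * ‖subgrad X g x‖ := by positivity
        rw [hD]
        nlinarith
      · exact mul_nonneg (by positivity) (mul_nonneg (hg0 x) (hw0 j _))
      · exact norm_nonneg _
    · have := hψ.continuous
      fun_prop
  have hlim := lintegral_ofReal_le_of_eventually_eq (μ := gibbs ν U)
    (f := fun x => c * (g x * st (dist x₀ x - 2) * dist x₀ x ^ r)) ?_ ?_ hbound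
  · have hfin : ∫⁻ x, ENNReal.ofReal (g x * dist x₀ x ^ r) ∂(gibbs ν U) ≤
        ENNReal.ofReal c⁻¹ *
          ∫⁻ x, ENNReal.ofReal (c * (g x * st (dist x₀ x - 2) * dist x₀ x ^ r)) ∂(gibbs ν U) +
        ENNReal.ofReal (3 ^ r) * ∫⁻ x, ENNReal.ofReal (‖subgrad X g x‖ + g x) ∂(gibbs ν U) := by
      refine lintegral_ofReal_le_mul_add (by positivity) (by positivity) (by fun_prop) ?_
      refine Eventually.of_forall fun x => ?_
      rw [← mul_assoc, inv_mul_cancel₀ hc.ne', one_mul]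
      have e3 := norm_nonneg (subgrad X g x)
      have e4 := hg0 x
      have e5 : (0 : ℝ) < 3 ^ r := by positivity
      have e6 : 0 ≤ dist x₀ x ^ r := by positivity
      rcases le_total (dist x₀ x) 3 with h3 | h3
      · have e7 : dist x₀ x ^ r ≤ 3 ^ r := Real.rpow_le_rpow dist_nonneg h3 h.pos.le
        have e8 : 0 ≤ g x * st (dist x₀ x - 2) * dist x₀ x ^ r :=
          mul_nonneg (mul_nonneg e4 (Real.smoothTransition.nonneg _)) e6
        nlinarith
      · rw [show st (dist x₀ x - 2) = 1 from Real.smoothTransition.one_of_one_le (by linarith)]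
        have : 0 ≤ 3 ^ r * (‖subgrad X g x‖ + g x) := by positivity
        linarith
    refine hfin.trans ?_
    rw [ENNReal.ofReal_add (by positivity) (by positivity), add_mul,
      ENNReal.ofReal_mul (by positivity), mul_assoc]
    gcongr
  · intro j
    have := (hw j).continuous
    fun_prop
  · intro x
    obtain ⟨N, hN⟩ := exists_nat_ge (dist x₀ x + 1)
    filter_upwards [eventually_ge_atTop N] with j hj
    have hj' : (N : ℝ) ≤ j := by exact_mod_cast hj
    have : st (j - dist x₀ x) = 1 := Real.smoothTransition.one_of_one_le (by linarith)
    simp [w, this]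

/-- Cut-offs at radius $j$ have slopes bounded independently of $j$, so Fatou extends the inequality
to functions without compact support. -/
lemma sobolev [ProperSpace M] {ε α β : ℝ} (hε : 0 < ε) (hα : 0 < α)
    (hβ : 0 < β) (hS : ClassicalSobolev X ν ε α β) :
    ∃ A : ℝ, 0 < A ∧ ∀ φ : M → ℝ, LipDiff n ν φ →
      (∫⁻ x, ENNReal.ofReal (|φ x| ^ (2 + ε)) ∂ν) ^ (2 / (2 + ε)) ≤
        ENNReal.ofReal A * ∫⁻ x, ENNReal.ofReal (‖subgrad X φ x‖ ^ 2 + φ x ^ 2) ∂ν := by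
  obtain ⟨S, hS0, hSb⟩ := exists_deriv_smoothTransition_le
  refine ⟨2 * α + 2 * α * S ^ 2 + β, by positivity, fun φ hφ => ?_⟩
  have hφc := hφ.continuous
  set st := Real.smoothTransition
  have hstc : Continuous st := Real.smoothTransition.continuous
  have hst1 : ∀ t, |st t| ≤ 1 := fun t => by
    rw [abs_of_nonneg (Real.smoothTransition.nonneg t)]; exact Real.smoothTransition.le_one t
  let w : ℕ → ℝ → ℝ := fun j t => st (j - t)
  have hw : ∀ j, ContDiff ℝ 1 (w j) := fun j =>
    Real.smoothTransition.contDiff.comp (contDiff_const.sub contDiff_id)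
  have hwd : ∀ j t, |deriv (w j) t| ≤ S := fun j t => by
    have h2 := (hasDerivAt_smoothTransition (j - t)).comp_const_sub (j : ℝ) t
    rw [h2.deriv, abs_neg]
    exact hSb _
  set B := ENNReal.ofReal (2 * α + 2 * α * S ^ 2 + β) *
    ∫⁻ x, ENNReal.ofReal (‖subgrad X φ x‖ ^ 2 + φ x ^ 2) ∂ν
  have hpow : ∀ x : M → ℝ, ∫⁻ y, ‖x y‖ₑ ^ (2 + ε) ∂ν =
      ∫⁻ y, ENNReal.ofReal (|x y| ^ (2 + ε)) ∂ν := fun x => by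
    congr with y
    rw [← ofReal_norm, ENNReal.ofReal_rpow_of_nonneg (norm_nonneg _) (by positivity),
      Real.norm_eq_abs]
  have hbound : ∀ j : ℕ, ∫⁻ x, ENNReal.ofReal (|φ x * w j (dist x₀ x)| ^ (2 + ε)) ∂ν ≤
      B ^ ((2 + ε) / 2) := by
    intro j
    obtain ⟨hψ, hψg⟩ := h.norm_subgrad_mul_dist_le hφ (hw j) (fun t => hst1 _) (hwd j)
    have hsupp : Function.support (fun x => φ x * w j (dist x₀ x)) ⊆ Metric.closedBall x₀ j := by
      intro x hx
      rw [Function.mem_support] at hx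
      by_contra hlt
      apply hx
      have : st (j - dist x₀ x) = 0 := Real.smoothTransition.zero_of_nonpos
        (by rw [Metric.mem_closedBall, not_le, dist_comm] at hlt; linarith)
      simp [w, this]
    have hcs : HasCompactSupport (fun x => φ x * w j (dist x₀ x)) :=
      IsCompact.of_isClosed_subset (isCompact_closedBall x₀ j) (isClosed_tsupport _)
        (closure_minimal hsupp Metric.isClosed_closedBall)
    have key := hS _ hψ.isTestFunction hcs
    rw [hpow] at key
    have hle : ENNReal.ofReal α * (∫⁻ x, ‖subgrad X (fun x => φ x * w j (dist x₀ x)) x‖ₑ ^ 2 ∂ν) +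
        ENNReal.ofReal β * ∫⁻ x, ‖φ x * w j (dist x₀ x)‖ₑ ^ 2 ∂ν ≤ B := by
      have hsq : ∀ (F : Type _) [NormedAddCommGroup F] (z : M → F), ∫⁻ x, ‖z x‖ₑ ^ 2 ∂ν =
          ∫⁻ x, ENNReal.ofReal (‖z x‖ ^ 2) ∂ν := fun F _ z => by
        congr with y
        rw [← ofReal_norm, ENNReal.ofReal_pow (norm_nonneg _)]
      simp only [B]
      rw [hsq, hsq, ← lintegral_ofReal_const_mul hα.le, ← lintegral_ofReal_const_mul hβ.le,
        ← lintegral_ofReal_const_mul (by positivity), ← lintegral_add_right']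
      · refine lintegral_mono_ae ?_
        filter_upwards [hψg] with x hx
        rw [← ENNReal.ofReal_add (by positivity) (by positivity)]
        apply ENNReal.ofReal_le_ofReal
        have e1 : ‖subgrad X (fun x => φ x * w j (dist x₀ x)) x‖ ^ 2 ≤
            2 * ‖subgrad X φ x‖ ^ 2 + 2 * S ^ 2 * φ x ^ 2 := by
          have := pow_le_pow_left₀ (norm_nonneg _) hx 2
          have e := sq_nonneg (S * |φ x| - ‖subgrad X φ x‖)
          have e' := sq_abs (φ x)
          nlinarith
        have e2 : ‖φ x * w j (dist x₀ x)‖ ^ 2 ≤ φ x ^ 2 := by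
          rw [norm_mul, mul_pow, Real.norm_eq_abs, sq_abs]
          exact mul_le_of_le_one_right (sq_nonneg _) (pow_le_one₀ (norm_nonneg _) (hst1 _))
        have e3 := mul_le_mul_of_nonneg_left e1 hα.le
        have e4 := mul_le_mul_of_nonneg_left e2 hβ.le
        have e5 : 0 ≤ (2 * α * S ^ 2 + β) * ‖subgrad X φ x‖ ^ 2 := by positivity
        have e6 : 0 ≤ 2 * α * φ x ^ 2 := by positivity
        nlinarith
      · have := hψ.continuous
        fun_prop
    have h2 := ENNReal.rpow_le_rpow (key.trans hle) (by positivity : 0 ≤ (2 + ε) / 2)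
    rwa [← ENNReal.rpow_mul, show 2 / (2 + ε) * ((2 + ε) / 2) = 1 by field_simp,
      ENNReal.rpow_one] at h2
  have hlim := lintegral_ofReal_le_of_eventually_eq (μ := ν)
    (f := fun x => |φ x| ^ (2 + ε)) ?_ ?_ hbound
  · have h2 := ENNReal.rpow_le_rpow hlim (by positivity : 0 ≤ 2 / (2 + ε))
    rwa [← ENNReal.rpow_mul, show (2 + ε) / 2 * (2 / (2 + ε)) = 1 by field_simp,
      ENNReal.rpow_one] at h2
  · intro j
    have := (hw j).continuous
    have hc : Continuous fun x => |φ x * w j (dist x₀ x)| := by fun_prop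
    exact (hc.rpow_const fun _ => Or.inr (by positivity)).aemeasurable
  · intro x
    obtain ⟨N, hN⟩ := exists_nat_ge (dist x₀ x + 1)
    filter_upwards [eventually_ge_atTop N] with j hj
    have hj' : (N : ℝ) ≤ j := by exact_mod_cast hj
    have : st (j - dist x₀ x) = 1 := Real.smoothTransition.one_of_one_le (by linarith)
    simp [w, this]

end Confining
end

/-! ### Poincaré inequality for the Gibbs measure. -/

section

variable {n m : ℕ} {M : Type*} [MetricSpace M] [ChartedSpace (EuclideanSpace ℝ (Fin n)) M]
    [MeasurableSpace M] {ν : Measure M} {X : Fin m → (x : M) → TangentSpace (𝓡 n) x}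
    {x₀ : M} {U : M → ℝ} {r : ℝ}

lemma LocalPoincare.setLIntegral_le [BorelSpace M] [ProperSpace M] [IsFiniteMeasureOnCompacts ν]
    (hP : LocalPoincare X ν x₀) {R : ℝ} (hR : 0 < R) :
    ∃ c : ℝ, 0 < c ∧ ∀ v : M → ℝ, LipDiff n ν v → ∃ k : ℝ,
      ∫⁻ x in Metric.ball x₀ R, ENNReal.ofReal ((v x - k) ^ 2) ∂ν ≤
        ENNReal.ofReal c * ∫⁻ x in Metric.ball x₀ R, ENNReal.ofReal (‖subgrad X v x‖ ^ 2) ∂ν := by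
  obtain ⟨c, hc, hP⟩ := hP R hR
  refine ⟨c, hc, fun v hv => ⟨⨍ y in Metric.ball x₀ R, v y ∂ν, ?_⟩⟩
  have h1 := hP v hv.isTestFunction
  have hsq : ∀ z : ℝ, ‖z‖ₑ ^ 2 = ENNReal.ofReal (z ^ 2) := fun z => by
    rw [← ofReal_norm, ← ENNReal.ofReal_pow (norm_nonneg _), Real.norm_eq_abs, sq_abs]
  have hsq' : ∀ z : EuclideanSpace ℝ (Fin m), ‖z‖ₑ ^ 2 = ENNReal.ofReal (‖z‖ ^ 2) := fun z => by
    rw [← ofReal_norm, ENNReal.ofReal_pow (norm_nonneg _)]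
  simp_rw [hsq, hsq'] at h1
  have htop : ν (Metric.ball x₀ R) ≠ ⊤ := Metric.isBounded_ball.measure_lt_top.ne
  by_cases h0 : ν (Metric.ball x₀ R) = 0
  · rw [Measure.restrict_eq_zero.2 h0]
    simp
  rw [setLAverage_eq, setLAverage_eq, ← mul_div_assoc] at h1
  rwa [ENNReal.div_le_iff h0 htop, ENNReal.div_mul_cancel h0 htop] at h1

namespace Confining

variable (h : Confining X ν x₀ U r)
include h
variable [BorelSpace M] [ProperSpace M] [IsFiniteMeasureOnCompacts ν]
  [IsFiniteMeasure (gibbs ν U)]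

/-- Inside a ball, $e^{-U}$ is bounded above and below, so the local inequality transfers; $k$ is
the local mean. Outside, $1\le d^r/(4C)$, and the U-bound for $(v-k)^2$ with
$|\nabla(v-k)^2|\le|\nabla v|^2+(v-k)^2$ leaves half of the total, which is absorbed. -/
lemma poincare (hP : LocalPoincare X ν x₀) :
    ∃ C : ℝ, 0 < C ∧ ∀ v : M → ℝ, LipDiff n ν v →
      ∫⁻ x, ENNReal.ofReal (v x ^ 2) ∂(gibbs ν U) ≠ ⊤ → ∃ k : ℝ,
        ∫⁻ x, ENNReal.ofReal ((v x - k) ^ 2) ∂(gibbs ν U) ≤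
          ENNReal.ofReal C * ∫⁻ x, ENNReal.ofReal (‖subgrad X v x‖ ^ 2) ∂(gibbs ν U) := by
  obtain ⟨C, hC, hUb⟩ := h.lintegral_mul_dist_rpow_le
  -- The radius solves $R^r=4C$, so that the absorbed coefficient is $(4C)^{-1}\cdot C\cdot2=1/2$.
  set R : ℝ := (4 * C) ^ r⁻¹ with hR
  have hR0 : 0 < R := by positivity
  have hRr : R ^ r = 4 * C := by
    rw [hR, ← Real.rpow_mul (by positivity), inv_mul_cancel₀ h.pos.ne', Real.rpow_one]
  obtain ⟨c, hc, hloc⟩ := hP.setLIntegral_le hR0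
  have hUc := h.pot.continuous
  obtain ⟨b, hb⟩ := (isCompact_closedBall x₀ R).exists_bound_of_continuousOn hUc.continuousOn
  refine ⟨2 * (Real.exp b * c * Real.exp b + 1 / 4), by positivity, fun v hv hv2 => ?_⟩
  obtain ⟨k, hk⟩ := hloc v hv
  refine ⟨k, ?_⟩
  have hvc := hv.continuous
  have hdc := h.continuous_dist_rpow
  have hmv := (h.aemeasurable_subgrad_gibbs hv).norm
  set μ := gibbs ν U with hμ
  set G := ∫⁻ x, ENNReal.ofReal (‖subgrad X v x‖ ^ 2) ∂μ with hG
  set I := ∫⁻ x, ENNReal.ofReal ((v x - k) ^ 2) ∂μ with hI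
  have hItop : I ≠ ⊤ := by
    have : I ≤ ENNReal.ofReal 2 * ∫⁻ x, ENNReal.ofReal (v x ^ 2) ∂μ +
        ENNReal.ofReal (2 * k ^ 2) * ∫⁻ x, ENNReal.ofReal 1 ∂μ := by
      refine lintegral_ofReal_le_mul_add (by positivity) (by positivity) (by fun_prop) ?_
      exact Eventually.of_forall fun x => by nlinarith [sq_nonneg (v x + k)]
    refine ne_top_of_le_ne_top ?_ this
    rw [lintegral_const]
    finiteness
  apply ENNReal.le_mul_of_le_mul_add_half hItop
  have hball : MeasurableSet (Metric.ball x₀ R) := measurableSet_ball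
  have hg : LipDiff n ν fun x => (v x - k) ^ 2 :=
    hv.comp (Φ := fun t => (t - k) ^ 2) fun x => by fun_prop
  have hgrad : ∀ᵐ x ∂ν, ‖subgrad X (fun x => (v x - k) ^ 2) x‖ ≤
      ‖subgrad X v x‖ ^ 2 + (v x - k) ^ 2 := by
    filter_upwards [hv.2] with x hx
    have hder : HasDerivAt (fun t => (t - k) ^ 2) (2 * (v x - k)) (v x) := by
      simpa using ((hasDerivAt_id (v x)).sub_const k).fun_pow 2
    rw [subgrad_comp X hx hder, norm_smul, norm_mul, Real.norm_eq_abs, Real.norm_eq_abs, abs_two]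
    nlinarith [sq_nonneg (‖subgrad X v x‖ - |v x - k|), sq_abs (v x - k)]
  have hout : ∫⁻ x in (Metric.ball x₀ R)ᶜ, ENNReal.ofReal ((v x - k) ^ 2) ∂μ ≤
      ENNReal.ofReal (1 / 4) * G + ENNReal.ofReal (1 / 2) * I := by
    calc ∫⁻ x in (Metric.ball x₀ R)ᶜ, ENNReal.ofReal ((v x - k) ^ 2) ∂μ
        ≤ ∫⁻ x in (Metric.ball x₀ R)ᶜ,
            ENNReal.ofReal ((4 * C)⁻¹ * ((v x - k) ^ 2 * dist x₀ x ^ r)) ∂μ := by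
          refine setLIntegral_mono_ae (by fun_prop) (Eventually.of_forall fun x hx => ?_)
          apply ENNReal.ofReal_le_ofReal
          have hx' : R ≤ dist x₀ x := by
            rw [mem_compl_iff, Metric.mem_ball, not_lt, dist_comm] at hx; exact hx
          have := Real.rpow_le_rpow hR0.le hx' h.pos.le
          rw [hRr] at this
          rw [inv_mul_eq_div, le_div_iff₀ (by positivity)]
          exact mul_le_mul_of_nonneg_left this (sq_nonneg _)
      _ ≤ ∫⁻ x, ENNReal.ofReal ((4 * C)⁻¹ * ((v x - k) ^ 2 * dist x₀ x ^ r)) ∂μ :=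
          setLIntegral_le_lintegral _ _
      _ ≤ ENNReal.ofReal (4 * C)⁻¹ * (ENNReal.ofReal C *
            ∫⁻ x, ENNReal.ofReal (‖subgrad X (fun x => (v x - k) ^ 2) x‖ + (v x - k) ^ 2) ∂μ) := by
          rw [lintegral_ofReal_const_mul (by positivity)]
          gcongr
          exact hUb _ hg fun x => sq_nonneg _
      _ ≤ ENNReal.ofReal (1 / 4) * (ENNReal.ofReal 1 * G + ENNReal.ofReal 2 * I) := by
          rw [← mul_assoc, ← ENNReal.ofReal_mul (by positivity),
            show (4 * C)⁻¹ * C = 1 / 4 by field_simp]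
          gcongr
          refine lintegral_ofReal_le_mul_add zero_le_one zero_le_two (hmv.pow_const 2) ?_
          filter_upwards [gibbs_absolutelyContinuous hgrad] with x hx
          linarith
      _ = _ := by
          rw [mul_add, ← mul_assoc, ← mul_assoc, ← ENNReal.ofReal_mul (by positivity),
            ← ENNReal.ofReal_mul (by positivity)]
          norm_num
  have hin : ∫⁻ x in Metric.ball x₀ R, ENNReal.ofReal ((v x - k) ^ 2) ∂μ ≤
      ENNReal.ofReal (Real.exp b * c * Real.exp b) * G := by
    have hset : ∀ F : M → ℝ, ∫⁻ x in Metric.ball x₀ R, ENNReal.ofReal (F x) ∂μ =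
        ∫⁻ x in Metric.ball x₀ R, ENNReal.ofReal (Real.exp (-U x) * F x) ∂ν := fun F => by
      rw [hμ, gibbs, restrict_withDensity hball]
      exact lintegral_ofReal_gibbs hUc F
    have hUb' : ∀ x ∈ Metric.ball x₀ R, |U x| ≤ b := fun x hx =>
      hb x (Metric.ball_subset_closedBall hx)
    calc ∫⁻ x in Metric.ball x₀ R, ENNReal.ofReal ((v x - k) ^ 2) ∂μ
        ≤ ∫⁻ x in Metric.ball x₀ R, ENNReal.ofReal (Real.exp b * (v x - k) ^ 2) ∂ν := by
          rw [hset]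
          refine setLIntegral_mono_ae (by fun_prop) (Eventually.of_forall fun x hx => ?_)
          gcongr
          linarith [neg_abs_le (U x), hUb' x hx]
      _ ≤ ENNReal.ofReal (Real.exp b) * (ENNReal.ofReal c *
            ∫⁻ x in Metric.ball x₀ R, ENNReal.ofReal (‖subgrad X v x‖ ^ 2) ∂ν) := by
          rw [lintegral_ofReal_const_mul (by positivity)]
          gcongr
      _ ≤ ENNReal.ofReal (Real.exp b) * (ENNReal.ofReal c * (ENNReal.ofReal (Real.exp b) *
            ∫⁻ x in Metric.ball x₀ R, ENNReal.ofReal (‖subgrad X v x‖ ^ 2) ∂μ)) := by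
          gcongr
          rw [hset, ← lintegral_ofReal_const_mul (by positivity)]
          refine lintegral_mono_ae ?_
          filter_upwards [ae_restrict_mem hball] with x hx
          apply ENNReal.ofReal_le_ofReal
          rw [← mul_assoc, ← Real.exp_add]
          refine le_mul_of_one_le_left (sq_nonneg _) (Real.one_le_exp ?_)
          linarith [le_abs_self (U x), hUb' x hx]
      _ ≤ ENNReal.ofReal (Real.exp b) * (ENNReal.ofReal c * (ENNReal.ofReal (Real.exp b) * G)) := by
          gcongr
          exact setLIntegral_le_lintegral _ _
      _ = _ := by
          rw [← mul_assoc, ← mul_assoc, ← ENNReal.ofReal_mul (by positivity),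
            ← ENNReal.ofReal_mul (by positivity)]
  calc I = _ := (lintegral_add_compl _ hball).symm
    _ ≤ ENNReal.ofReal (Real.exp b * c * Real.exp b) * G +
        (ENNReal.ofReal (1 / 4) * G + ENNReal.ofReal (1 / 2) * I) := add_le_add hin hout
    _ = _ := by
        rw [ENNReal.ofReal_add (by positivity) (by positivity), add_mul, add_assoc]

end Confining
end

/-! ### The bound on the moment of order $r+1=p$. -/

section

variable {n m : ℕ} {M : Type*} [MetricSpace M] [ChartedSpace (EuclideanSpace ℝ (Fin n)) M]
    [MeasurableSpace M] {ν : Measure M} {X : Fin m → (x : M) → TangentSpace (𝓡 n) x}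
    {x₀ : M} {U : M → ℝ} {r : ℝ}

namespace Confining

variable (h : Confining X ν x₀ U r)
include h
variable [BorelSpace M]

/-- The U-bound for $g^2d$ produces the weight $d^{r+1}$, and the cross term $d|g||\nabla g|$ is
absorbed through the Young-type hypothesis. The remainder $b$ is left abstract because for a
truncation $g$ of $f$ it is expressed by $f$, not by $g$. -/
lemma lintegral_sq_mul_dist_rpow_add_one_le [ProperSpace M] [IsFiniteMeasureOnCompacts ν] :
    ∃ η C : ℝ, 0 < η ∧ 0 < C ∧ ∀ g b : M → ℝ, LipDiff n ν g → AEMeasurable b (gibbs ν U) →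
      (∀ᵐ x ∂ν, ∀ s : ℝ, 0 ≤ s →
        s * (|g x| * ‖subgrad X g x‖) ≤ η * s ^ (r + 1) * g x ^ 2 + b x) →
      ∫⁻ x, ENNReal.ofReal (‖subgrad X g x‖ ^ 2 + g x ^ 2) ∂(gibbs ν U) ≠ ⊤ →
      ∫⁻ x, ENNReal.ofReal (g x ^ 2 * dist x₀ x ^ (r + 1)) ∂(gibbs ν U) ≤
        ENNReal.ofReal C * ∫⁻ x, ENNReal.ofReal (b x + g x ^ 2) ∂(gibbs ν U) := by
  obtain ⟨C, hC, hUb⟩ := h.lintegral_mul_dist_rpow_le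
  -- Three copies of `η` have to be absorbed: two from the cross term and one from `e12`; thus
  -- $C\cdot3\eta=1/2$.
  set η : ℝ := 1 / (6 * C) with hη
  have hη0 : 0 < η := by positivity
  -- Beyond radius `T`, $\eta d^r\ge1$, which lets $k_j$ be absorbed into $\eta k_jd^r$.
  set T : ℝ := (η⁻¹) ^ r⁻¹ with hT
  have hT0 : 0 < T := by positivity
  have hTr : T ^ r = η⁻¹ := by
    rw [hT, ← Real.rpow_mul (by positivity), inv_mul_cancel₀ h.pos.ne', Real.rpow_one]
  refine ⟨η, 2 * (C * (2 + T)), hη0, by positivity, fun g b hg hb hyoung hfin => ?_⟩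
  have hgc := hg.continuous
  have hdc := h.continuous_dist_rpow
  have hb0 : ∀ᵐ x ∂ν, 0 ≤ b x := by
    filter_upwards [hyoung] with x hx
    have h1 := hx 0 le_rfl
    have hr := h.pos
    rwa [Real.zero_rpow (by linarith), zero_mul, mul_zero, zero_mul, zero_add] at h1
  set μ := gibbs ν U with hμ
  have hac : μ ≪ ν := gibbs_absolutelyContinuous
  have hmg := (h.aemeasurable_subgrad_gibbs hg).norm
  have hsqd : ∀ t : ℝ, HasDerivAt (fun t => t ^ 2) (2 * t) t := fun t => by
    simpa using hasDerivAt_pow 2 t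
  have hg2 : LipDiff n ν fun x => g x ^ 2 := hg.comp (Φ := fun t => t ^ 2) fun x => by fun_prop
  -- The unweighted U-bound for $g^2$ provides the finiteness that absorption needs, since $k_j\le
  -- j+1$.
  have hfin_r : ∫⁻ x, ENNReal.ofReal (g x ^ 2 * dist x₀ x ^ r) ∂μ ≠ ⊤ := by
    refine ne_top_of_le_ne_top (ENNReal.mul_ne_top ENNReal.ofReal_ne_top ?_)
      (hUb _ hg2 fun x => sq_nonneg _)
    refine ne_top_of_le_ne_top
      (ENNReal.mul_ne_top (ENNReal.ofReal_ne_top (r := 2)) hfin) ?_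
    rw [← lintegral_ofReal_const_mul zero_le_two]
    refine lintegral_mono_ae (hac ?_)
    filter_upwards [hg.2] with x hx
    apply ENNReal.ofReal_le_ofReal
    rw [subgrad_comp X hx (hsqd _), norm_smul, Real.norm_eq_abs, abs_mul, abs_two]
    nlinarith [sq_nonneg (‖subgrad X g x‖ - |g x|), sq_abs (g x), sq_nonneg ‖subgrad X g x‖]
  -- Bounded substitutes for $t$: on $t\ge0$ they have slope at most $1$, stay below $t$ and
  -- converge to it.
  let k : ℕ → ℝ → ℝ := fun j t => (j + 1) * t / ((j + 1) + t)
  have hkd : ∀ (j : ℕ) (t : ℝ), 0 ≤ t →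
      HasDerivAt (k j) ((j + 1) ^ 2 / ((j + 1) + t) ^ 2) t := fun j t ht => by
    have h1 : ((j : ℝ) + 1) + t ≠ 0 := by positivity
    have := ((hasDerivAt_id t).const_mul ((j : ℝ) + 1)).fun_div
      ((hasDerivAt_id t).const_add ((j : ℝ) + 1)) h1
    convert! this using 1
    simp only [id]
    ring
  have hk0 : ∀ (j : ℕ) (t : ℝ), 0 ≤ t → 0 ≤ k j t := fun j t ht => by positivity
  have hkt : ∀ (j : ℕ) (t : ℝ), 0 ≤ t → k j t ≤ t := fun j t ht => by
    simp only [k]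
    rw [div_le_iff₀ (by positivity)]
    nlinarith [sq_nonneg t]
  have hkj : ∀ (j : ℕ) (t : ℝ), 0 ≤ t → k j t ≤ j + 1 := fun j t ht => by
    simp only [k]
    rw [div_le_iff₀ (by positivity)]
    nlinarith [sq_nonneg ((j : ℝ) + 1)]
  have hkc : ∀ j, LipDiff n ν fun x => k j (dist x₀ x) := fun j =>
    h.dist_lipDiff.comp (Φ := k j) fun x => by
      have h1 : ((j : ℝ) + 1) + dist x₀ x ≠ 0 := by positivity
      exact ContDiffAt.div (by fun_prop) (by fun_prop) h1
  have hbound : ∀ j : ℕ, ∫⁻ x, ENNReal.ofReal (g x ^ 2 * k j (dist x₀ x) * dist x₀ x ^ r) ∂μ ≤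
      ENNReal.ofReal (2 * (C * (2 + T))) * ∫⁻ x, ENNReal.ofReal (b x + g x ^ 2) ∂μ := by
    intro j
    have hkcont := (hkc j).continuous
    have hG : LipDiff n ν fun x => g x ^ 2 * k j (dist x₀ x) := hg2.mul (hkc j)
    apply ENNReal.le_mul_of_le_mul_add_half
    · refine ne_top_of_le_ne_top (ENNReal.mul_ne_top
        (ENNReal.ofReal_ne_top (r := (j : ℝ) + 1)) hfin_r) ?_
      rw [← lintegral_ofReal_const_mul (by positivity)]
      refine lintegral_mono fun x => ENNReal.ofReal_le_ofReal ?_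
      have h1 := hkj j _ (dist_nonneg (x := x₀) (y := x))
      have h2 : 0 ≤ g x ^ 2 * dist x₀ x ^ r := by positivity
      nlinarith
    · refine (hUb _ hG fun x => mul_nonneg (sq_nonneg _) (hk0 j _ dist_nonneg)).trans ?_
      have h1 : ∫⁻ x, ENNReal.ofReal (‖subgrad X (fun x => g x ^ 2 * k j (dist x₀ x)) x‖ +
          g x ^ 2 * k j (dist x₀ x)) ∂μ ≤
          ENNReal.ofReal (2 + T) * ∫⁻ x, ENNReal.ofReal (b x + g x ^ 2) ∂μ +
          ENNReal.ofReal (3 * η) *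
            ∫⁻ x, ENNReal.ofReal (g x ^ 2 * k j (dist x₀ x) * dist x₀ x ^ r) ∂μ := by
        refine lintegral_ofReal_le_mul_add (by positivity) (by positivity) (by fun_prop) (hac ?_)
        filter_upwards [hg.2, h.dist_lipDiff.2, h.dist_le, hyoung, hb0] with x e1 e2 e3 e4 e5
        set d := dist x₀ x with hd
        have hd0 : 0 ≤ d := dist_nonneg
        have e6 := hk0 j d hd0
        have e7 := hkt j d hd0
        have e8 : ‖subgrad X (fun x => g x ^ 2 * k j (dist x₀ x)) x‖ ≤
            g x ^ 2 + 2 * (k j d * (|g x| * ‖subgrad X g x‖)) := by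
          rw [subgrad_mul X (e1.comp_real (Φ := fun t => t ^ 2) (hsqd _).differentiableAt)
            (e2.comp_real (hkd j _ dist_nonneg).differentiableAt),
            subgrad_comp X e1 (hsqd _), subgrad_comp X e2 (hkd j _ dist_nonneg)]
          refine (norm_add_le _ _).trans ?_
          have n1 : ‖2 * g x‖ = 2 * |g x| := by rw [norm_mul, Real.norm_two, Real.norm_eq_abs]
          have n2 : ‖((j : ℝ) + 1) ^ 2 / ((j + 1) + d) ^ 2‖ =
            ((j : ℝ) + 1) ^ 2 / ((j + 1) + d) ^ 2 := Real.norm_of_nonneg (by positivity)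
          rw [norm_smul, norm_smul, norm_smul, norm_smul, Real.norm_of_nonneg (sq_nonneg _),
            Real.norm_of_nonneg e6, n1, n2]
          have e9 : ((j : ℝ) + 1) ^ 2 / ((j + 1) + d) ^ 2 ≤ 1 := by
            rw [div_le_one (by positivity)]
            exact pow_le_pow_left₀ (by positivity) (by linarith) 2
          have e10 : ((j : ℝ) + 1) ^ 2 / ((j + 1) + d) ^ 2 *
              ‖subgrad X (fun y => dist x₀ y) x‖ ≤ 1 := mul_le_one₀ e9 (norm_nonneg _) e3
          have e11 := mul_le_mul_of_nonneg_left e10 (sq_nonneg (g x))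
          nlinarith
        have e9 := e4 (k j d) e6
        have e10 : k j d ^ (r + 1) ≤ k j d * d ^ r := by
          rw [Real.rpow_add_one' e6 (by linarith [h.pos]), mul_comm]
          exact mul_le_mul_of_nonneg_left (Real.rpow_le_rpow e6 e7 h.pos.le) e6
        have e11 := mul_le_mul_of_nonneg_left e10 (by positivity : 0 ≤ η * g x ^ 2)
        have e12 : k j d ≤ η * (k j d * d ^ r) + T := by
          rcases le_total d T with hdT | hdT
          · have : 0 ≤ η * (k j d * d ^ r) := by positivity
            linarith
          · have h1 := Real.rpow_le_rpow hT0.le hdT h.pos.le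
            rw [hTr, inv_le_iff_one_le_mul₀ hη0] at h1
            have h2 := mul_le_mul_of_nonneg_left h1 e6
            nlinarith
        have e13 := mul_le_mul_of_nonneg_left e12 (sq_nonneg (g x))
        have e14 : 0 ≤ T * b x := mul_nonneg hT0.le e5
        have e15 := sq_nonneg (g x)
        nlinarith
      refine (mul_le_mul_right h1 _).trans (le_of_eq ?_)
      rw [mul_add, ← mul_assoc, ← mul_assoc, ← ENNReal.ofReal_mul hC.le,
        ← ENNReal.ofReal_mul hC.le, show C * (3 * η) = 1 / 2 by rw [hη]; field_simp; norm_num]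
  refine lintegral_ofReal_le_of_tendsto (F := fun j x =>
    g x ^ 2 * k j (dist x₀ x) * dist x₀ x ^ r) ?_ ?_ hbound
  · intro j
    have := (hkc j).continuous
    fun_prop
  · intro x
    have h1 : Tendsto (fun j : ℕ => k j (dist x₀ x)) atTop (𝓝 (dist x₀ x)) := by
      have h2 : ∀ j : ℕ, k j (dist x₀ x) =
          dist x₀ x - dist x₀ x ^ 2 / ((j + 1) + dist x₀ x) := fun j => by
        have h1 : ((j : ℝ) + 1) + dist x₀ x ≠ 0 := by positivity
        simp only [k]
        field_simp
        ring
      simp_rw [h2]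
      have h3 : Tendsto (fun j : ℕ => ((j : ℝ) + 1) + dist x₀ x) atTop atTop :=
        tendsto_atTop_add_const_right _ _
          (tendsto_atTop_add_const_right _ _ tendsto_natCast_atTop_atTop)
      simpa using tendsto_const_nhds.sub (h3.const_div_atTop (dist x₀ x ^ 2))
    have h4 := (h1.const_mul (g x ^ 2)).mul_const (dist x₀ x ^ r)
    rwa [show g x ^ 2 * dist x₀ x * dist x₀ x ^ r = g x ^ 2 * dist x₀ x ^ (r + 1) by
      rw [Real.rpow_add_one' dist_nonneg (by linarith [h.pos])]; ring] at h4

end Confining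
end

/-! ### Defective logarithmic Sobolev inequality. -/

section

variable {n m : ℕ} {M : Type*} [MetricSpace M] [ChartedSpace (EuclideanSpace ℝ (Fin n)) M]
    [MeasurableSpace M] {ν : Measure M} {X : Fin m → (x : M) → TangentSpace (𝓡 n) x}
    {x₀ : M} {U : M → ℝ} {r : ℝ}

namespace Confining

variable (h : Confining X ν x₀ U r)
include h
variable [BorelSpace M]

omit [BorelSpace M] in
-- Differentiating $e^{-U/2}$ costs $g^2|\nabla U|^2$, of order $g^2d^{2r}$; $r<1$ gives $2r\le
-- r+1$, so the weight $1+d^{r+1}$ suffices.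
lemma norm_subgrad_mul_exp_sq_le :
    ∃ D : ℝ, 0 < D ∧ ∀ g : M → ℝ, LipDiff n ν g →
      LipDiff n ν (fun x => g x * Real.exp (-(U x) / 2)) ∧
      ∀ᵐ x ∂ν, ‖subgrad X (fun x => g x * Real.exp (-(U x) / 2)) x‖ ^ 2 +
          (g x * Real.exp (-(U x) / 2)) ^ 2 ≤
        Real.exp (-U x) * (D * (‖subgrad X g x‖ ^ 2 + g x ^ 2 * (1 + dist x₀ x ^ (r + 1)))) := by
  obtain ⟨A, hA, hgrow⟩ := h.growth
  refine ⟨2 * A ^ 2 + 2, by positivity, fun g hg => ?_⟩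
  have hE : LipDiff n ν fun x => Real.exp (-(U x) / 2) :=
    h.pot.comp (Φ := fun t => Real.exp (-t / 2)) fun x => by fun_prop
  refine ⟨hg.mul hE, ?_⟩
  have hder : ∀ t : ℝ, HasDerivAt (fun t => Real.exp (-t / 2)) (Real.exp (-t / 2) * (-1 / 2)) t :=
    fun t => ((hasDerivAt_neg t).div_const 2).exp
  filter_upwards [hg.2, h.pot.2, hgrow] with x e1 e2 e3
  have hexp : Real.exp (-U x) = Real.exp (-(U x) / 2) ^ 2 := by
    rw [← Real.exp_nat_mul]; congr 1; push_cast; ring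
  rw [subgrad_mul X e1 (e2.comp_real (Φ := fun t => Real.exp (-t / 2)) (hder _).differentiableAt),
    subgrad_comp X e2 (hder _), hexp]
  set E := Real.exp (-(U x) / 2) with hEdef
  have hE0 : 0 < E := Real.exp_pos _
  set d := dist x₀ x
  have hd0 : 0 ≤ d := dist_nonneg
  have h1 : ‖g x • (E * (-1 / 2)) • subgrad X U x + E • subgrad X g x‖ ≤
      E * (|g x| * (A * (1 + d ^ r)) / 2 + ‖subgrad X g x‖) := by
    refine (norm_add_le _ _).trans ?_
    have n1 : ‖E * (-1 / 2)‖ = E / 2 := by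
      rw [norm_mul, Real.norm_of_nonneg hE0.le]; norm_num; ring
    rw [norm_smul, norm_smul, norm_smul, n1, Real.norm_eq_abs, Real.norm_of_nonneg hE0.le]
    have := mul_le_mul_of_nonneg_left e3 (by positivity : 0 ≤ |g x| * (E / 2))
    nlinarith
  have h2 := pow_le_pow_left₀ (norm_nonneg _) h1 2
  have h3 : (d ^ r) ^ 2 ≤ 1 + d ^ (r + 1) := by
    rw [← Real.rpow_natCast, ← Real.rpow_mul hd0]
    rcases le_total d 1 with hd1 | hd1
    · have e4 := Real.rpow_le_one hd0 hd1 (by have := h.pos; positivity : 0 ≤ r * (2 : ℕ))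
      have e5 : 0 ≤ d ^ (r + 1) := by positivity
      linarith
    · have := Real.rpow_le_rpow_of_exponent_le hd1
        (by push_cast; linarith [h.lt_one] : r * (2 : ℕ) ≤ r + 1)
      linarith
  have h4 : (|g x| * (A * (1 + d ^ r)) / 2 + ‖subgrad X g x‖) ^ 2 ≤
      2 * ‖subgrad X g x‖ ^ 2 + g x ^ 2 * (2 * A ^ 2 * (1 + d ^ (r + 1))) := by
    have e4 : (|g x| * (A * (1 + d ^ r)) / 2 + ‖subgrad X g x‖) ^ 2 ≤
        2 * ‖subgrad X g x‖ ^ 2 + g x ^ 2 * (A ^ 2 * ((1 + d ^ r) ^ 2 / 2)) := by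
      rw [← sq_abs (g x)]
      nlinarith [sq_nonneg (|g x| * (A * (1 + d ^ r)) / 2 - ‖subgrad X g x‖)]
    have e5 : (1 + d ^ r) ^ 2 / 2 ≤ 2 * (1 + d ^ (r + 1)) := by
      have : 0 ≤ d ^ (r + 1) := by positivity
      nlinarith [sq_nonneg (d ^ r - 1)]
    have e6 := mul_le_mul_of_nonneg_left e5 (by positivity : 0 ≤ g x ^ 2 * A ^ 2)
    linarith
  have h5 := mul_le_mul_of_nonneg_left h4 (sq_nonneg E)
  have h6 : 0 ≤ E ^ 2 * (g x ^ 2 * d ^ (r + 1)) := by positivity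
  have h7 : 0 ≤ E ^ 2 * (2 * A ^ 2 * ‖subgrad X g x‖ ^ 2) := by positivity
  have h8 : 0 ≤ E ^ 2 * g x ^ 2 := by positivity
  nlinarith

/-- With $\varphi=ge^{-U/2}$ and $y=|\varphi|^\varepsilon/N^{\varepsilon/2}$ one has
$\log(g^2/N)=U+\frac2\varepsilon\log y$. The growth of $U$ handles the first term. For the second,
$g^2|\varphi|^\varepsilon d\mu=|\varphi|^{2+\varepsilon}d\nu$ is controlled by Sobolev, with a
tangent line of the logarithm in the role of Jensen's inequality. -/
lemma defective_logSobolev [ProperSpace M] [IsFiniteMeasure (gibbs ν U)] {ε α β : ℝ}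
    (hε : 0 < ε) (hα : 0 < α) (hβ : 0 < β) (hS : ClassicalSobolev X ν ε α β) :
    ∃ C : ℝ, 0 < C ∧ ∀ g : M → ℝ, LipDiff n ν g →
      Integrable (fun x => ‖subgrad X g x‖ ^ 2 + g x ^ 2 * (1 + dist x₀ x ^ (r + 1))) (gibbs ν U) →
      ∀ N : ℝ, 0 < N → ∫ x, g x ^ 2 ∂(gibbs ν U) = N →
      Integrable (fun x => g x ^ 2 * Real.log (g x ^ 2 / N)) (gibbs ν U) ∧
      ∫ x, g x ^ 2 * Real.log (g x ^ 2 / N) ∂(gibbs ν U) ≤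
        C * ∫ x, (‖subgrad X g x‖ ^ 2 + g x ^ 2 * (1 + dist x₀ x ^ (r + 1))) ∂(gibbs ν U) := by
  obtain ⟨A, hA, hSob⟩ := h.sobolev hε hα hβ hS
  obtain ⟨D, hD, hgrad⟩ := h.norm_subgrad_mul_exp_sq_le
  obtain ⟨B, hB, hUle⟩ := h.pot_le
  refine ⟨B + 2 / ε * ((2 + ε) / 2 * (A * D)), by positivity, fun g hg hQ N hN hgN => ?_⟩
  obtain ⟨hφ, hφle⟩ := hgrad g hg
  have hUc := h.pot.continuous
  have hgc := hg.continuous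
  set μ := gibbs ν U with hμ
  set Q : M → ℝ := fun x => ‖subgrad X g x‖ ^ 2 + g x ^ 2 * (1 + dist x₀ x ^ (r + 1)) with hQdef
  have hgQ : ∀ x, g x ^ 2 ≤ Q x := fun x => by
    have e1 : 0 ≤ g x ^ 2 * dist x₀ x ^ (r + 1) := by positivity
    have e2 := sq_nonneg ‖subgrad X g x‖
    simp only [hQdef]
    linarith
  have hQ0 : ∀ x, 0 ≤ Q x := fun x => (sq_nonneg _).trans (hgQ x)
  have hg2 : Integrable (fun x => g x ^ 2) μ := by
    refine hQ.mono' (by fun_prop) (Eventually.of_forall fun x => ?_)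
    rw [Real.norm_of_nonneg (sq_nonneg _)]
    exact hgQ x
  set φ : M → ℝ := fun x => g x * Real.exp (-(U x) / 2) with hφdef
  have hφ2 : ∀ x, φ x ^ 2 = Real.exp (-U x) * g x ^ 2 := fun x => by
    rw [hφdef]
    simp only
    rw [mul_pow, ← Real.exp_nat_mul, mul_comm]
    congr 2; push_cast; ring
  set S : ℝ := A * D * ∫ x, Q x ∂μ with hSdef
  have hNQ : N ≤ ∫ x, Q x ∂μ := hgN ▸ integral_mono hg2 hQ hgQ
  have hS0 : 0 < S := by
    have : 0 < ∫ x, Q x ∂μ := lt_of_lt_of_le hN hNQ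
    positivity
  have hφc : Continuous φ := hφ.continuous
  have hpow : Continuous fun x => |φ x| ^ ε := hφc.abs.rpow_const fun _ => Or.inr hε.le
  have hSle : (∫⁻ x, ENNReal.ofReal (|φ x| ^ (2 + ε)) ∂ν) ^ (2 / (2 + ε)) ≤ ENNReal.ofReal S := by
    refine (hSob φ hφ).trans ?_
    have h1 : ∫⁻ x, ENNReal.ofReal (‖subgrad X φ x‖ ^ 2 + φ x ^ 2) ∂ν ≤
        ENNReal.ofReal (D * ∫ x, Q x ∂μ) := by
      rw [← integral_const_mul, ofReal_integral_eq_lintegral_ofReal (hQ.const_mul D)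
        (Eventually.of_forall fun x => mul_nonneg hD.le (hQ0 x)), hμ, lintegral_ofReal_gibbs hUc]
      refine lintegral_mono_ae ?_
      filter_upwards [hφle] with x hx
      exact ENNReal.ofReal_le_ofReal hx
    rw [hSdef, mul_assoc, ENNReal.ofReal_mul hA.le]
    gcongr
  have hmu : ∫⁻ x, ENNReal.ofReal (g x ^ 2 * |φ x| ^ ε) ∂μ ≤
      ENNReal.ofReal (S ^ ((2 + ε) / 2)) := by
    have h2 := ENNReal.rpow_le_rpow hSle (by positivity : 0 ≤ (2 + ε) / 2)
    rw [← ENNReal.rpow_mul, show 2 / (2 + ε) * ((2 + ε) / 2) = 1 by field_simp,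
      ENNReal.rpow_one, ENNReal.ofReal_rpow_of_nonneg hS0.le (by positivity)] at h2
    refine le_trans (le_of_eq ?_) h2
    rw [hμ, lintegral_ofReal_gibbs hUc]
    congr with x
    rw [Real.rpow_add' (abs_nonneg _) (by positivity), Real.rpow_two, sq_abs, hφ2, mul_assoc]
  have hI1 : Integrable (fun x => g x ^ 2 * |φ x| ^ ε) μ := by
    refine ⟨by fun_prop, ?_⟩
    rw [hasFiniteIntegral_iff_ofReal (Eventually.of_forall fun x => by positivity)]
    exact lt_of_le_of_lt hmu ENNReal.ofReal_lt_top
  have hI1le : ∫ x, g x ^ 2 * |φ x| ^ ε ∂μ ≤ S ^ ((2 + ε) / 2) := by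
    rw [← ofReal_integral_eq_lintegral_ofReal hI1 (Eventually.of_forall fun x => by positivity),
      ENNReal.ofReal_le_ofReal_iff (by positivity)] at hmu
    exact hmu
  -- The tangent point is the Sobolev bound for the mean of $y$ under $g^2d\mu/N$.
  set a : ℝ := (S / N) ^ ((2 + ε) / 2) with ha
  have ha0 : 0 < a := by positivity
  set y : M → ℝ := fun x => |φ x| ^ ε / N ^ (ε / 2) with hy
  set F : M → ℝ := fun x => B * Q x +
    2 / ε * (g x ^ 2 * |φ x| ^ ε * (N ^ (ε / 2) * a)⁻¹ + g x ^ 2 * (Real.log a - 1)) with hF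
  have hFI : Integrable F μ := (hQ.const_mul B).add
    (((hI1.mul_const _).add (hg2.mul_const _)).const_mul _)
  have hupper : ∀ x, g x ^ 2 * Real.log (g x ^ 2 / N) ≤ F x := fun x => by
    by_cases hgx : g x = 0
    · have e1 : 0 ≤ B * Q x := mul_nonneg hB.le (hQ0 x)
      simp only [hF, hgx]
      simpa using e1
    have hg2pos : 0 < g x ^ 2 := by positivity
    have hφpos : 0 < φ x ^ 2 := by rw [hφ2]; positivity
    have habs : 0 < |φ x| := abs_pos.2 fun h0 => by rw [h0] at hφpos; simp at hφpos
    have hypos : 0 < y x := by simp only [hy]; positivity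
    have e1 : Real.log (y x) ≤ y x / a + Real.log a - 1 := by
      have := Real.log_le_sub_one_of_pos (div_pos hypos ha0)
      rw [Real.log_div hypos.ne' ha0.ne'] at this
      linarith
    have e2 : Real.log (y x) = ε / 2 * (Real.log (g x ^ 2 / N) - U x) := by
      simp only [hy]
      rw [Real.log_div (by positivity) (by positivity), Real.log_rpow habs, Real.log_rpow hN,
        Real.log_div hg2pos.ne' hN.ne']
      have : Real.log (φ x ^ 2) = -U x + Real.log (g x ^ 2) := by
        rw [hφ2, Real.log_mul (Real.exp_ne_zero _) hg2pos.ne', Real.log_exp]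
      rw [← sq_abs, Real.log_pow] at this
      push_cast at this
      linear_combination (ε / 2) * this
    have e3 : g x ^ 2 * U x ≤ B * Q x := by
      have e4 := mul_le_mul_of_nonneg_left (hUle x) hg2pos.le
      have e5 : 0 ≤ B * ‖subgrad X g x‖ ^ 2 := by positivity
      simp only [hQdef]
      linarith
    have e6 : Real.log (g x ^ 2 / N) = U x + 2 / ε * Real.log (y x) := by
      rw [e2]; field_simp; ring
    have e7 := mul_le_mul_of_nonneg_left e1 (by positivity : 0 ≤ 2 / ε * g x ^ 2)
    have e8 : y x / a = |φ x| ^ ε * (N ^ (ε / 2) * a)⁻¹ := by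
      simp only [hy]; rw [mul_inv]; ring
    rw [e8] at e7
    rw [e6]
    simp only [hF]
    linarith
  -- From $\log x\ge1-1/x$. As $\mu$ is finite, this lower bound and the integrable majorant `F`
  -- give integrability.
  have hlower : ∀ x, -N ≤ g x ^ 2 * Real.log (g x ^ 2 / N) := fun x => by
    by_cases hgx : g x = 0
    · simp [hgx, hN.le]
    have hg2pos : 0 < g x ^ 2 := by positivity
    have e1 := Real.one_sub_inv_le_log_of_pos (div_pos hg2pos hN)
    have e2 := mul_le_mul_of_nonneg_left e1 hg2pos.le
    rw [inv_div] at e2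
    have e3 : g x ^ 2 * (1 - N / g x ^ 2) = g x ^ 2 - N := by field_simp
    linarith
  have hmeas : AEStronglyMeasurable (fun x => g x ^ 2 * Real.log (g x ^ 2 / N)) μ := by
    have : Measurable g := hgc.measurable
    fun_prop
  have hLI : Integrable (fun x => g x ^ 2 * Real.log (g x ^ 2 / N)) μ := by
    refine Integrable.mono' (hFI.abs.add (integrable_const N)) hmeas
      (Eventually.of_forall fun x => ?_)
    rw [Real.norm_eq_abs, abs_le]
    simp only [Pi.add_apply]
    have := hupper x
    have := hlower x
    have := le_abs_self (F x)
    have := abs_nonneg (F x)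
    constructor <;> linarith
  refine ⟨hLI, ?_⟩
  have hint : ∫ x, F x ∂μ = B * ∫ x, Q x ∂μ +
      2 / ε * ((∫ x, g x ^ 2 * |φ x| ^ ε ∂μ) * (N ^ (ε / 2) * a)⁻¹ + N * (Real.log a - 1)) := by
    have hI2 : Integrable (fun x => g x ^ 2 * |φ x| ^ ε * (N ^ (ε / 2) * a)⁻¹ +
      g x ^ 2 * (Real.log a - 1)) μ := (hI1.mul_const _).add (hg2.mul_const _)
    simp only [hF]
    rw [integral_add (hQ.const_mul B) (hI2.const_mul _),
      integral_const_mul, integral_const_mul, integral_add (hI1.mul_const _) (hg2.mul_const _),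
      integral_mul_const, integral_mul_const, hgN]
  refine (integral_mono hLI hFI hupper).trans ?_
  rw [hint]
  have e1 : (∫ x, g x ^ 2 * |φ x| ^ ε ∂μ) * (N ^ (ε / 2) * a)⁻¹ ≤ N := by
    rw [← div_eq_mul_inv, div_le_iff₀ (by positivity)]
    refine hI1le.trans (le_of_eq ?_)
    rw [ha, Real.div_rpow hS0.le hN.le, show (2 + ε) / 2 = 1 + ε / 2 by ring,
      Real.rpow_add hN, Real.rpow_one]
    field_simp
  have e2 : N * Real.log a ≤ (2 + ε) / 2 * S := by
    rw [ha, Real.log_rpow (by positivity)]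
    have e3 := Real.log_le_sub_one_of_pos (div_pos hS0 hN)
    have e4 := mul_le_mul_of_nonneg_left e3 (by positivity : 0 ≤ N * ((2 + ε) / 2))
    have e5 : N * ((2 + ε) / 2) * (S / N - 1) = (2 + ε) / 2 * S - N * ((2 + ε) / 2) := by
      field_simp
    have e6 : 0 < N * ((2 + ε) / 2) := by positivity
    linarith
  have e3 : (∫ x, g x ^ 2 * |φ x| ^ ε ∂μ) * (N ^ (ε / 2) * a)⁻¹ + N * (Real.log a - 1) ≤
      (2 + ε) / 2 * S := by linarith
  have e4 := mul_le_mul_of_nonneg_left e3 (by positivity : 0 ≤ 2 / ε)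
  rw [hSdef] at e4
  linarith

end Confining
end

/-! ### The function $H_q$ and the truncation of $f$. -/

lemma Hq_nonneg (q t : ℝ) : 0 ≤ Hq q t := by
  unfold Hq; split_ifs <;> positivity

lemma abs_rpow_le_Hq {q s t : ℝ} (hs : 2 ≤ s) (hsq : s ≤ q) : |t| ^ s ≤ Hq q t := by
  unfold Hq
  split_ifs with ht
  · rw [← sq_abs t, ← Real.rpow_two]
    rcases (abs_nonneg t).eq_or_lt with h0 | h0
    · rw [← h0, Real.zero_rpow (by linarith), Real.zero_rpow two_ne_zero]
    · exact Real.rpow_le_rpow_of_exponent_ge h0 ht hs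
  · exact Real.rpow_le_rpow_of_exponent_le (not_le.1 ht).le hsq

lemma sq_le_Hq {q t : ℝ} (hq : 2 ≤ q) : t ^ 2 ≤ Hq q t := by
  have := abs_rpow_le_Hq (t := t) le_rfl hq
  rwa [Real.rpow_two, sq_abs] at this

lemma sq_le_Hq_div_mul_sq {q z t : ℝ} (hq : 2 ≤ q) (ht : t ≠ 0) :
    z ^ 2 ≤ Hq q (z / t) * t ^ 2 := by
  have h1 := mul_le_mul_of_nonneg_right (sq_le_Hq (t := z / t) hq) (sq_nonneg t)
  rwa [div_pow, div_mul_cancel₀ _ (pow_ne_zero 2 ht)] at h1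

/-- Young's inequality for $(\eta^{1/p}s)(\eta^{-1/p}w)$, without the factors $1/p$ and $1/p'$. -/
lemma exists_mul_le_rpow_add_rpow {p p' : ℝ} (hp : p.HolderConjugate p') {η : ℝ} (hη : 0 < η) :
    ∃ C : ℝ, 0 < C ∧ ∀ s w : ℝ, 0 ≤ s → 0 ≤ w → s * w ≤ η * s ^ p + C * w ^ p' := by
  set l := η ^ p⁻¹ with hl
  have hl0 : 0 < l := by positivity
  have hp1 := hp.lt
  have hp1' := hp.symm.lt
  refine ⟨(l⁻¹) ^ p', by positivity, fun s w hs hw => ?_⟩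
  have h1 := Real.young_inequality_of_nonneg (mul_nonneg hl0.le hs)
    (mul_nonneg (inv_nonneg.2 hl0.le) hw) hp
  rw [Real.mul_rpow hl0.le hs, Real.mul_rpow (by positivity) hw, hl, ← Real.rpow_mul hη.le,
    inv_mul_cancel₀ (by linarith), Real.rpow_one, ← hl] at h1
  have h2 : l * s * (l⁻¹ * w) = s * w := by field_simp
  have h3 : η * s ^ p / p ≤ η * s ^ p := div_le_self (by positivity) hp1.le
  have h4 : l⁻¹ ^ p' * w ^ p' / p' ≤ l⁻¹ ^ p' * w ^ p' := div_le_self (by positivity) hp1'.le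
  linarith

/-- A smooth truncation of `t ↦ t` away from zero, which vanishes to a prescribed order at the
boundary of its support. -/
lemma exists_truncation (k : ℕ) (hk : 2 ≤ k) :
    ∃ (θ σ : ℝ → ℝ) (A : ℝ), 0 < A ∧ ContDiff ℝ 1 θ ∧ (∀ t, 0 ≤ σ t ∧ σ t ≤ 1) ∧
      (∀ t, θ t = t * σ t ^ k) ∧ (∀ t, t ^ 2 ≤ 2 → σ t = 0) ∧ (∀ t, 3 ≤ t ^ 2 → σ t = 1) ∧
      ∀ t, |deriv θ t| ≤ A * σ t ^ (k - 1) := by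
  obtain ⟨C, hC, hCb⟩ := exists_deriv_smoothTransition_le
  have hσ0 : ∀ t : ℝ, 0 ≤ Real.smoothTransition (t ^ 2 - 2) := fun t =>
    Real.smoothTransition.nonneg _
  refine ⟨fun t => t * Real.smoothTransition (t ^ 2 - 2) ^ k,
    fun t => Real.smoothTransition (t ^ 2 - 2), 1 + 6 * k * C, by positivity, ?_,
    fun t => ⟨hσ0 t, Real.smoothTransition.le_one _⟩,
    fun t => rfl, fun t ht => Real.smoothTransition.zero_of_nonpos (by linarith),
    fun t ht => Real.smoothTransition.one_of_one_le (by linarith), fun t => ?_⟩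
  · have h1 : ContDiff ℝ 1 fun t : ℝ => Real.smoothTransition (t ^ 2 - 2) :=
      Real.smoothTransition.contDiff.comp (by fun_prop)
    exact contDiff_id.mul (h1.pow k)
  · have h0 : HasDerivAt (fun t : ℝ => t ^ 2 - 2) (2 * t) t := by
      simpa using (hasDerivAt_pow 2 t).sub_const 2
    have h1 : HasDerivAt (fun t : ℝ => Real.smoothTransition (t ^ 2 - 2))
        (deriv Real.smoothTransition (t ^ 2 - 2) * (2 * t)) t :=
      HasDerivAt.comp (h₂ := Real.smoothTransition) t (hasDerivAt_smoothTransition (t ^ 2 - 2)) h0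
    have h2 := (hasDerivAt_id t).fun_mul (h1.fun_pow k)
    rw [show deriv (fun t : ℝ => t * Real.smoothTransition (t ^ 2 - 2) ^ k) t = _ from h2.deriv]
    set s := Real.smoothTransition (t ^ 2 - 2) with hs
    have hs0 : 0 ≤ s := hσ0 t
    have hs1 : s ≤ 1 := Real.smoothTransition.le_one _
    -- The derivative of the cut-off lives on $t^2\le3$; the inner derivative $2t$ and the prefactor
    -- $t$ then cost at most $6$, whence the $6kC$ in the constant.
    have h3 : t ^ 2 * |deriv Real.smoothTransition (t ^ 2 - 2)| ≤ 3 * C := by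
      rcases le_or_gt (t ^ 2) 3 with h | h
      · exact mul_le_mul h (hCb _) (abs_nonneg _) (by norm_num)
      · rw [deriv_smoothTransition_eq_zero (by linarith), abs_zero, mul_zero]
        positivity
    have h4 : s ^ k ≤ s ^ (k - 1) := pow_le_pow_of_le_one hs0 hs1 (Nat.sub_le _ _)
    have h5 : |id t * (k * s ^ (k - 1) * (deriv Real.smoothTransition (t ^ 2 - 2) * (2 * t)))| =
        2 * k * s ^ (k - 1) * (t ^ 2 * |deriv Real.smoothTransition (t ^ 2 - 2)|) := by
      rw [id, abs_mul, abs_mul, abs_mul, abs_mul, abs_mul, abs_two, ← sq_abs t,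
        abs_of_nonneg (pow_nonneg hs0 _), Nat.abs_cast]
      ring
    refine (abs_add_le _ _).trans ?_
    rw [h5, one_mul, abs_of_nonneg (pow_nonneg hs0 _)]
    have h6 := mul_le_mul_of_nonneg_left h3 (by positivity : 0 ≤ 2 * k * s ^ (k - 1))
    linarith

/-- For $t^2<3$, $\log x\le x-1$ gives $t^2\log t^2\le t^2-1+(t^2-1)^2$, and
$(t^2-1)^2\le9(|t|-1)^2$. The other $16$ pays for a negative $g^2\log g^2\ge-1$, possible only when
$t^2>2$, where $|t|-1\ge1/4$. -/
lemma sq_mul_log_sq_le {t g : ℝ} (h3 : 3 ≤ t ^ 2 → g = t) (h2 : t ^ 2 ≤ 2 → g = 0) :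
    t ^ 2 * Real.log (t ^ 2) ≤ t ^ 2 - 1 + 25 * (|t| - 1) ^ 2 + g ^ 2 * Real.log (g ^ 2) := by
  have hs := sq_abs t
  have ha := abs_nonneg t
  rcases le_or_gt 3 (t ^ 2) with h | h
  · rw [h3 h]
    nlinarith [sq_nonneg (|t| - 1)]
  · have e1 : t ^ 2 * Real.log (t ^ 2) ≤ t ^ 2 - 1 + 9 * (|t| - 1) ^ 2 := by
      by_cases ht : t = 0
      · simp [ht]
      · have hpos : 0 < t ^ 2 := by positivity
        have e2 := mul_le_mul_of_nonneg_left (Real.log_le_sub_one_of_pos hpos) hpos.le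
        have e3 : (|t| + 1) ^ 2 ≤ 9 := by nlinarith
        have e4 := mul_le_mul_of_nonneg_right e3 (sq_nonneg (|t| - 1))
        have e5 : (|t| + 1) ^ 2 * (|t| - 1) ^ 2 = (t ^ 2 - 1) ^ 2 := by rw [← hs]; ring
        nlinarith
    have e6 : -(16 * (|t| - 1) ^ 2) ≤ g ^ 2 * Real.log (g ^ 2) := by
      by_cases hg0 : g = 0
      · have h0 : g ^ 2 * Real.log (g ^ 2) = 0 := by simp [hg0]
        rw [h0]
        linarith [sq_nonneg (|t| - 1)]
      · have hpos : 0 < g ^ 2 := by positivity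
        have ht2 : 2 < t ^ 2 := by
          by_contra hc
          exact hg0 (h2 (not_lt.1 hc))
        have e2 := mul_le_mul_of_nonneg_left (Real.one_sub_inv_le_log_of_pos hpos) hpos.le
        have e3 : g ^ 2 * (1 - (g ^ 2)⁻¹) = g ^ 2 - 1 := by field_simp
        have e4 : 1 ≤ 16 * (|t| - 1) ^ 2 := by nlinarith
        linarith
    linarith

/-- Where $g\ne0$, $|t|>\sqrt2>4/3$, and then $|t|\le4(|t|-1)$. -/
lemma truncation_sq_le {t g s : ℝ} {k : ℕ} (hs0 : 0 ≤ s) (hs1 : s ≤ 1) (hg : g = t * s ^ k)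
    (h2 : t ^ 2 ≤ 2 → g = 0) : g ^ 2 ≤ 16 * (|t| - 1) ^ 2 := by
  rcases le_or_gt (t ^ 2) 2 with h | h
  · rw [h2 h, zero_pow two_ne_zero]; positivity
  · have e1 : g ^ 2 ≤ t ^ 2 := by
      rw [hg, mul_pow]
      exact mul_le_of_le_one_right (sq_nonneg _) (pow_le_one₀ (by positivity) (pow_le_one₀ hs0 hs1))
    have hs := sq_abs t
    have ha := abs_nonneg t
    have : 4 / 3 ≤ |t| := by nlinarith
    nlinarith

/-- The quotient $|\nabla g|/|g|$ may blow up like $\sigma^{-1}$ at the edge of the truncation, but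
$g^2=t^2\sigma^{2k}$ compensates for $\sigma^{-p'}$ because $2k\ge q\ge p'$. -/
lemma truncation_young {p' q A C η s z t g dg σ : ℝ} {p : ℝ} {k : ℕ}
    (hp' : 2 ≤ p') (hp'q : p' ≤ q) (hk : q ≤ 2 * k) (hk1 : 1 ≤ k) (hA : 0 < A) (hC : 0 < C)
    (hyoung : ∀ s w : ℝ, 0 ≤ s → 0 ≤ w → s * w ≤ η * s ^ p + C * w ^ p')
    (hs : 0 ≤ s) (hz : 0 ≤ z) (hσ0 : 0 ≤ σ) (hσ1 : σ ≤ 1)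
    (hg : g = t * σ ^ k) (hdg : |dg| ≤ A * σ ^ (k - 1)) :
    s * (|g| * (|dg| * z)) ≤ η * s ^ p * g ^ 2 + C * A ^ p' * (Hq q (z / t) * t ^ 2) := by
  have hrhs : 0 ≤ C * A ^ p' * (Hq q (z / t) * t ^ 2) :=
    mul_nonneg (by positivity) (mul_nonneg (Hq_nonneg _ _) (sq_nonneg _))
  by_cases hg0 : g = 0
  · rw [hg0]; simpa using hrhs
  have ht : t ≠ 0 := fun h => hg0 (by rw [hg, h, zero_mul])
  have hσ : 0 < σ := by
    refine lt_of_le_of_ne hσ0 fun h => hg0 ?_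
    rw [hg, ← h, zero_pow (by omega), mul_zero]
  have htp : 0 < |t| := abs_pos.2 ht
  set w := A * z / (σ * |t|) with hw
  have hw0 : 0 ≤ w := by positivity
  have h1 : |g| = |t| * σ ^ k := by rw [hg, abs_mul, abs_of_nonneg (pow_nonneg hσ0 _)]
  have h2 : |dg| * z ≤ |g| * w := by
    have h3 : |g| * w = A * σ ^ (k - 1) * z := by
      rw [h1, hw, ← Nat.sub_add_cancel hk1, pow_succ]
      simp only [Nat.add_sub_cancel]
      field_simp
    rw [h3]
    exact mul_le_mul_of_nonneg_right hdg hz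
  have h4 : s * (|g| * (|dg| * z)) ≤ g ^ 2 * (s * w) := by
    have := mul_le_mul_of_nonneg_left h2 (mul_nonneg hs (abs_nonneg g))
    rw [← sq_abs g]
    linarith
  have h5 := mul_le_mul_of_nonneg_left (hyoung s w hs hw0) (sq_nonneg g)
  have h6 : g ^ 2 * w ^ p' ≤ A ^ p' * (Hq q (z / t) * t ^ 2) := by
    have e1 : w = A * σ⁻¹ * |z / t| := by
      rw [hw, abs_div, abs_of_nonneg hz]; field_simp
    rw [e1, Real.mul_rpow (by positivity) (abs_nonneg _), Real.mul_rpow hA.le (by positivity),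
      Real.inv_rpow hσ0]
    have e2 : g ^ 2 * (σ ^ p')⁻¹ ≤ t ^ 2 := by
      rw [← div_eq_mul_inv, div_le_iff₀ (by positivity), ← sq_abs g, h1, mul_pow, sq_abs]
      refine mul_le_mul_of_nonneg_left ?_ (sq_nonneg t)
      rw [← pow_mul, ← Real.rpow_natCast]
      refine Real.rpow_le_rpow_of_exponent_ge hσ hσ1 ?_
      push_cast
      linarith
    have e3 := abs_rpow_le_Hq (t := z / t) hp' hp'q
    have e4 := mul_le_mul e2 e3 (by positivity) (sq_nonneg t)
    have e5 := mul_le_mul_of_nonneg_left e4 (by positivity : 0 ≤ A ^ p')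
    linarith
  have h7 := mul_le_mul_of_nonneg_left h6 hC.le
  linarith

/-! ### The tight modified logarithmic Sobolev inequality. -/

section

variable {n m : ℕ} {M : Type*} [MetricSpace M] [ChartedSpace (EuclideanSpace ℝ (Fin n)) M]
    [MeasurableSpace M] {ν : Measure M} {X : Fin m → (x : M) → TangentSpace (𝓡 n) x}
    {x₀ : M} {U : M → ℝ} {r : ℝ}

namespace Confining

variable (h : Confining X ν x₀ U r)
include h
variable [BorelSpace M] [ProperSpace M] [IsFiniteMeasureOnCompacts ν]
  [IsProbabilityMeasure (gibbs ν U)]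

/-- With $a=\int|f|\le1=\int f^2$, $\int(|f|-1)^2=2(1-a)\le2(1-a^2)$, which is twice the variance of
$|f|$ and so at most $2\int(|f|-k)^2$ for every $k$. -/
lemma integral_abs_sub_one_sq_le (hP : LocalPoincare X ν x₀) {q : ℝ} (hq : 2 ≤ q) :
    ∃ C : ℝ, 0 < C ∧ ∀ f : M → ℝ, LipDiff n ν f → Integrable (fun x => f x ^ 2) (gibbs ν U) →
      ∫ x, f x ^ 2 ∂(gibbs ν U) = 1 →
      Integrable (fun x => Hq q (‖subgrad X f x‖ / f x) * f x ^ 2) (gibbs ν U) →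
      ∫ x, (|f x| - 1) ^ 2 ∂(gibbs ν U) ≤
        C * ∫ x, Hq q (‖subgrad X f x‖ / f x) * f x ^ 2 ∂(gibbs ν U) := by
  obtain ⟨C, hC, hpoin⟩ := h.poincare hP
  refine ⟨4 * C, by positivity, fun f hf hf2 hf1 hΓ => ?_⟩
  have hfc := hf.continuous
  set μ := gibbs ν U with hμ
  set Γ : M → ℝ := fun x => Hq q (‖subgrad X f x‖ / f x) * f x ^ 2 with hΓdef
  have hΓ0 : ∀ x, 0 ≤ Γ x := fun x => mul_nonneg (Hq_nonneg _ _) (sq_nonneg _)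
  have hfabs : Integrable (fun x => |f x|) μ := by
    refine (hf2.add (integrable_const 1)).mono' (by fun_prop) (Eventually.of_forall fun x => ?_)
    simp only [Pi.add_apply]
    rw [Real.norm_eq_abs, abs_abs]
    nlinarith [sq_nonneg (|f x| - 1), sq_abs (f x), abs_nonneg (f x)]
  set a := ∫ x, |f x| ∂μ with ha
  have ha0 : 0 ≤ a := integral_nonneg fun x => abs_nonneg _
  have hexpand : ∀ k : ℝ, Integrable (fun x => (|f x| - k) ^ 2) μ ∧
      ∫ x, (|f x| - k) ^ 2 ∂μ = 1 - 2 * k * a + k ^ 2 := fun k => by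
    have e1 : (fun x => (|f x| - k) ^ 2) = fun x => f x ^ 2 - 2 * k * |f x| + k ^ 2 := by
      ext x
      rw [← sq_abs (f x)]; ring
    have e2 : Integrable (fun x => f x ^ 2 - 2 * k * |f x|) μ := hf2.sub (hfabs.const_mul _)
    rw [e1]
    refine ⟨e2.add (integrable_const _), ?_⟩
    rw [integral_add e2 (integrable_const _), integral_sub hf2 (hfabs.const_mul _),
      integral_const_mul, hf1, integral_const, probReal_univ, one_smul]
  have ha1 : a ≤ 1 := by
    have e1 := (hexpand a).2
    have e2 : 0 ≤ ∫ x, (|f x| - a) ^ 2 ∂μ := integral_nonneg fun x => sq_nonneg _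
    nlinarith
  -- Poincaré is applied to the $C^1$ regularisation $\sqrt{f^2+\eta}$ of $|f|$. Its gradient
  -- vanishes where $f=0$, consistently with the integrand on the right being $0$ there. The error
  -- is $4\eta=\zeta$.
  refine le_of_forall_pos_le_add fun ζ hζ => ?_
  set η := ζ / 4 with hη
  have hη0 : 0 < η := by positivity
  set v : M → ℝ := fun x => Real.sqrt (f x ^ 2 + η) with hv
  have hpos : ∀ t : ℝ, 0 < t ^ 2 + η := fun t => by positivity
  have hvL : LipDiff n ν v := hf.comp (Φ := fun t => Real.sqrt (t ^ 2 + η)) fun x =>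
    ContDiffAt.sqrt (by fun_prop) (hpos _).ne'
  have hvc := hvL.continuous
  have hv2 : ∀ x, v x ^ 2 = f x ^ 2 + η := fun x => Real.sq_sqrt (hpos _).le
  have hv0 : ∀ x, 0 < v x := fun x => Real.sqrt_pos.2 (hpos _)
  have hvI : Integrable (fun x => v x ^ 2) μ := by
    simp_rw [hv2]
    exact hf2.add (integrable_const _)
  have hfv : ∀ x, |f x| ≤ v x := fun x => Real.abs_le_sqrt (by linarith)
  have hgrad : ∀ᵐ x ∂ν, ‖subgrad X v x‖ ^ 2 ≤ Γ x := by
    filter_upwards [hf.2] with x hx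
    have hder : HasDerivAt (fun t => Real.sqrt (t ^ 2 + η)) (2 * f x / (2 * v x)) (f x) := by
      have h0 : HasDerivAt (fun t : ℝ => t ^ 2 + η) (2 * f x) (f x) := by
        simpa using (hasDerivAt_pow 2 (f x)).add_const η
      exact h0.sqrt (hpos _).ne'
    rw [hv, subgrad_comp X hx hder, norm_smul, mul_pow]
    by_cases hfx : f x = 0
    · rw [hfx]
      simpa using hΓ0 x
    · refine le_trans ?_ (sq_le_Hq_div_mul_sq hq hfx)
      refine mul_le_of_le_one_left (sq_nonneg _) (pow_le_one₀ (norm_nonneg _) ?_)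
      rw [mul_div_mul_left _ _ two_ne_zero, norm_div, Real.norm_of_nonneg (hv0 x).le,
        div_le_one (hv0 x)]
      exact hfv x
  obtain ⟨k, hk⟩ := hpoin v hvL (by
    rw [← ofReal_integral_eq_lintegral_ofReal hvI (Eventually.of_forall fun x => sq_nonneg _)]
    exact ENNReal.ofReal_ne_top)
  have hvk : ∫⁻ x, ENNReal.ofReal ((v x - k) ^ 2) ∂μ ≤ ENNReal.ofReal (C * ∫ x, Γ x ∂μ) := by
    refine hk.trans ?_
    rw [ENNReal.ofReal_mul hC.le, ofReal_integral_eq_lintegral_ofReal hΓ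
      (Eventually.of_forall hΓ0)]
    gcongr 1
    refine lintegral_mono_ae (gibbs_absolutelyContinuous ?_)
    filter_upwards [hgrad] with x hx
    exact ENNReal.ofReal_le_ofReal hx
  have hvkI : Integrable (fun x => (v x - k) ^ 2) μ := by
    refine ⟨by fun_prop, ?_⟩
    rw [hasFiniteIntegral_iff_ofReal (Eventually.of_forall fun x => sq_nonneg _)]
    exact lt_of_le_of_lt hvk ENNReal.ofReal_lt_top
  rw [← ofReal_integral_eq_lintegral_ofReal hvkI (Eventually.of_forall fun x => sq_nonneg _),
    ENNReal.ofReal_le_ofReal_iff (mul_nonneg hC.le (integral_nonneg hΓ0))] at hvk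
  have hcmp : ∫ x, (|f x| - k) ^ 2 ∂μ ≤ 2 * (∫ x, (v x - k) ^ 2 ∂μ) + 2 * η := by
    have e1 : ∫ x, (|f x| - k) ^ 2 ∂μ ≤ ∫ x, (2 * (v x - k) ^ 2 + 2 * η) ∂μ := by
      refine integral_mono (hexpand k).1 ((hvkI.const_mul 2).add (integrable_const _)) fun x => ?_
      have e2 : (v x - |f x|) ^ 2 ≤ η := by
        have := hv2 x
        have := hfv x
        nlinarith [sq_abs (f x), abs_nonneg (f x)]
      simp only
      nlinarith [sq_nonneg ((v x - k) + (v x - |f x|))]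
    rwa [integral_add (hvkI.const_mul 2) (integrable_const _), integral_const_mul,
      integral_const, probReal_univ, one_smul] at e1
  rw [(hexpand k).2] at hcmp
  rw [(hexpand 1).2]
  nlinarith [sq_nonneg (k - a)]

/-- Only the truncation $g$ enters the defective inequality, so its defect involves $\int g^2$ and
$\int g^2d^{r+1}$, both bounded by the $H_q$ energy of $f$. -/
lemma integrable_sq_mul_log_sq_of_integral_sq_eq_one (hP : LocalPoincare X ν x₀)
    {ε α β : ℝ} (hε : 0 < ε) (hα : 0 < α) (hβ : 0 < β) (hS : ClassicalSobolev X ν ε α β)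
    {q : ℝ} (hq : (r + 1) / r ≤ q) :
    ∃ C : ℝ, 0 < C ∧ ∀ f : M → ℝ, LipDiff n ν f → Integrable (fun x => f x ^ 2) (gibbs ν U) →
      ∫ x, f x ^ 2 ∂(gibbs ν U) = 1 →
      Integrable (fun x => Hq q (‖subgrad X f x‖ / f x) * f x ^ 2) (gibbs ν U) →
      Integrable (fun x => f x ^ 2 * Real.log (f x ^ 2)) (gibbs ν U) ∧
      ∫ x, f x ^ 2 * Real.log (f x ^ 2) ∂(gibbs ν U) ≤
        C * ∫ x, Hq q (‖subgrad X f x‖ / f x) * f x ^ 2 ∂(gibbs ν U) := by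
  have hr := h.pos
  have hp'2 : 2 ≤ (r + 1) / r := by rw [le_div_iff₀ hr]; linarith [h.lt_one]
  have hq2 : 2 ≤ q := hp'2.trans hq
  have hconj : (r + 1).HolderConjugate ((r + 1) / r) := by
    rw [Real.holderConjugate_iff]
    refine ⟨by linarith, ?_⟩
    have : r + 1 ≠ 0 := by linarith
    field_simp
    ring
  obtain ⟨k, hk⟩ := exists_nat_ge q
  have hk2 : 2 ≤ k := by exact_mod_cast hq2.trans hk
  obtain ⟨θ, σ, A, hA, hθ, hσ, hθσ, hσ0, hσ1, hdθ⟩ := exists_truncation k hk2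
  obtain ⟨CP, hCP, hpoin⟩ := h.integral_abs_sub_one_sq_le hP hq2
  obtain ⟨η, CU, hη, hCU, hUb⟩ := h.lintegral_sq_mul_dist_rpow_add_one_le
  obtain ⟨CY, hCY, hyoung⟩ := exists_mul_le_rpow_add_rpow hconj hη
  obtain ⟨CD, hCD, hdef⟩ := h.defective_logSobolev hε hα hβ hS
  set B : ℝ := CY * A ^ ((r + 1) / r) with hB
  have hB0 : 0 < B := by positivity
  -- The three terms bound $|\nabla g|^2$, the Young remainder in the moment bound, and $g^2$
  -- counted once directly and `CU` times in the moment bound.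
  set CQ : ℝ := A ^ 2 + CU * B + (1 + CU) * (16 * CP) with hCQ
  have hCQ0 : 0 < CQ := by positivity
  refine ⟨25 * CP + CD * CQ, by positivity, fun f hf hf2 hf1 hΓ => ?_⟩
  have hE := hpoin f hf hf2 hf1 hΓ
  have hfc := hf.continuous
  set μ := gibbs ν U with hμ
  set Γ : M → ℝ := fun x => Hq q (‖subgrad X f x‖ / f x) * f x ^ 2 with hΓdef
  have hΓ0 : ∀ x, 0 ≤ Γ x := fun x => mul_nonneg (Hq_nonneg _ _) (sq_nonneg _)
  have hEI : Integrable (fun x => (|f x| - 1) ^ 2) μ := by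
    refine ((hf2.const_mul 2).add (integrable_const 2)).mono' (by fun_prop)
      (Eventually.of_forall fun x => ?_)
    rw [Real.norm_of_nonneg (sq_nonneg _)]
    simp only [Pi.add_apply]
    nlinarith [sq_nonneg (|f x| + 1), sq_abs (f x)]
  set g : M → ℝ := fun x => θ (f x) with hg
  have hgL : LipDiff n ν g := hf.comp fun x => hθ.contDiffAt
  have hgc := hgL.continuous
  have hg0 : ∀ x, f x ^ 2 ≤ 2 → g x = 0 := fun x hx => by
    simp only [hg]
    rw [hθσ, hσ0 _ hx, zero_pow (by omega), mul_zero]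
  have hg3 : ∀ x, 3 ≤ f x ^ 2 → g x = f x := fun x hx => by
    simp only [hg]
    rw [hθσ, hσ1 _ hx, one_pow, mul_one]
  have hg16 : ∀ x, g x ^ 2 ≤ 16 * (|f x| - 1) ^ 2 := fun x =>
    truncation_sq_le (hσ (f x)).1 (hσ (f x)).2 (hθσ (f x)) (hg0 x)
  have hgf : ∀ x, g x ^ 2 ≤ f x ^ 2 := fun x => by
    simp only [hg]
    rw [hθσ, mul_pow]
    exact mul_le_of_le_one_right (sq_nonneg _) (pow_le_one₀ (pow_nonneg (hσ _).1 _)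
      (pow_le_one₀ (hσ _).1 (hσ _).2))
  have hgI : Integrable (fun x => g x ^ 2) μ := by
    refine hf2.mono' (by fun_prop) (Eventually.of_forall fun x => ?_)
    rw [Real.norm_of_nonneg (sq_nonneg _)]
    exact hgf x
  have hgint : ∫ x, g x ^ 2 ∂μ ≤ 16 * CP * ∫ x, Γ x ∂μ := by
    have e1 := integral_mono hgI (hEI.const_mul 16) hg16
    rw [integral_const_mul] at e1
    linarith
  have hgradeq : ∀ᵐ x ∂ν, ‖subgrad X g x‖ = |deriv θ (f x)| * ‖subgrad X f x‖ := by
    filter_upwards [hf.2] with x hx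
    rw [hg, subgrad_comp X hx (hθ.differentiable one_ne_zero _).hasDerivAt, norm_smul,
      Real.norm_eq_abs]
  have hac : μ ≪ ν := gibbs_absolutelyContinuous
  have hgrad2 : ∀ᵐ x ∂μ, ‖subgrad X g x‖ ^ 2 ≤ A ^ 2 * Γ x := by
    filter_upwards [hac hgradeq] with x hx
    rw [hx, mul_pow]
    rcases le_or_gt (f x ^ 2) 2 with h2 | h2
    · have : deriv θ (f x) = 0 := by
        have := hdθ (f x)
        rw [hσ0 _ h2, zero_pow (by omega), mul_zero] at this
        exact abs_nonpos_iff.1 this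
      rw [this, abs_zero, zero_pow two_ne_zero, zero_mul]
      exact mul_nonneg (sq_nonneg _) (hΓ0 x)
    · have hne : f x ≠ 0 := fun h0 => by rw [h0] at h2; norm_num at h2
      refine mul_le_mul ?_ (sq_le_Hq_div_mul_sq hq2 hne) (sq_nonneg _) (sq_nonneg _)
      refine pow_le_pow_left₀ (abs_nonneg _) ((hdθ _).trans ?_) 2
      exact mul_le_of_le_one_right hA.le (pow_le_one₀ (hσ _).1 (hσ _).2)
  have hmg := (h.aemeasurable_subgrad_gibbs hgL).norm
  have hGI : Integrable (fun x => ‖subgrad X g x‖ ^ 2) μ := by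
    refine (hΓ.const_mul (A ^ 2)).mono' (hmg.pow_const 2).aestronglyMeasurable ?_
    filter_upwards [hgrad2] with x hx
    rwa [Real.norm_of_nonneg (sq_nonneg _)]
  have hbI : Integrable (fun x => B * Γ x + g x ^ 2) μ := (hΓ.const_mul B).add hgI
  have hb0 : ∀ x, 0 ≤ B * Γ x + g x ^ 2 := fun x =>
    add_nonneg (mul_nonneg hB0.le (hΓ0 x)) (sq_nonneg _)
  have hUg := hUb g (fun x => B * Γ x) hgL (hΓ.const_mul B).aemeasurable (by
      filter_upwards [hgradeq] with x hx s hs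
      rw [hx]
      exact truncation_young hp'2 hq (hk.trans (by linarith [Nat.cast_nonneg (α := ℝ) k]))
        (by omega) hA hCY hyoung hs (norm_nonneg _) (hσ _).1 (hσ _).2 (hθσ _) (hdθ _)) (by
      rw [← ofReal_integral_eq_lintegral_ofReal (f := fun x => ‖subgrad X g x‖ ^ 2 + g x ^ 2)
        (hGI.add hgI) (Eventually.of_forall fun x => by positivity)]
      exact ENNReal.ofReal_ne_top)
  rw [← ofReal_integral_eq_lintegral_ofReal hbI (Eventually.of_forall hb0),
    ← ENNReal.ofReal_mul hCU.le] at hUg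
  have hdc : Continuous fun x : M => dist x₀ x ^ (r + 1) :=
    (continuous_const.dist continuous_id).rpow_const fun _ => Or.inr (by linarith)
  have hgdI : Integrable (fun x => g x ^ 2 * dist x₀ x ^ (r + 1)) μ := by
    refine ⟨by fun_prop, ?_⟩
    rw [hasFiniteIntegral_iff_ofReal (Eventually.of_forall fun x => by positivity)]
    exact lt_of_le_of_lt hUg ENNReal.ofReal_lt_top
  rw [← ofReal_integral_eq_lintegral_ofReal hgdI (Eventually.of_forall fun x => by positivity),
    ENNReal.ofReal_le_ofReal_iff (mul_nonneg hCU.le (integral_nonneg hb0)),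
    integral_add (hΓ.const_mul B) hgI, integral_const_mul] at hUg
  have hQI : Integrable (fun x => ‖subgrad X g x‖ ^ 2 + g x ^ 2 * (1 + dist x₀ x ^ (r + 1))) μ := by
    simp_rw [mul_add, mul_one]
    exact hGI.add (hgI.add hgdI)
  have hQle : ∫ x, (‖subgrad X g x‖ ^ 2 + g x ^ 2 * (1 + dist x₀ x ^ (r + 1))) ∂μ ≤
      CQ * ∫ x, Γ x ∂μ := by
    have e1 : Integrable (fun x => g x ^ 2 + g x ^ 2 * dist x₀ x ^ (r + 1)) μ := hgI.add hgdI
    simp_rw [mul_add, mul_one]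
    rw [integral_add hGI e1, integral_add hgI hgdI]
    have e2 := integral_mono_ae hGI (hΓ.const_mul (A ^ 2)) hgrad2
    rw [integral_const_mul] at e2
    have e3 := mul_le_mul_of_nonneg_left hgint (by positivity : 0 ≤ 1 + CU)
    rw [hCQ]
    linarith
  have hglog : Integrable (fun x => g x ^ 2 * Real.log (g x ^ 2)) μ ∧
      ∫ x, g x ^ 2 * Real.log (g x ^ 2) ∂μ ≤ CD * (CQ * ∫ x, Γ x ∂μ) := by
    have hΓint : 0 ≤ ∫ x, Γ x ∂μ := integral_nonneg hΓ0
    -- The defective inequality needs $N=\int g^2>0$. Passing from $\log(g^2/N)$ to $\log g^2$ adds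
    -- $N\log N$, which is nonpositive because $N\le\int f^2=1$.
    rcases (integral_nonneg (μ := μ) (f := fun x => g x ^ 2) fun x => sq_nonneg (g x)).eq_or_lt with hN | hN
    · have hzero : (fun x => g x ^ 2 * Real.log (g x ^ 2)) =ᵐ[μ] 0 := by
        filter_upwards [(integral_eq_zero_iff_of_nonneg (fun x => sq_nonneg (g x)) hgI).1 hN.symm]
          with x hx
        simp only [Pi.zero_apply] at hx
        simp [hx]
      refine ⟨(integrable_zero _ _ _).congr hzero.symm, ?_⟩
      rw [integral_congr_ae hzero]
      simp only [Pi.zero_apply, integral_zero]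
      positivity
    · set N := ∫ x, g x ^ 2 ∂μ with hNdef
      obtain ⟨h1, h2⟩ := hdef g hgL hQI N hN rfl
      have hN1 : N ≤ 1 := hf1 ▸ integral_mono hgI hf2 hgf
      have hlogN : Real.log N ≤ 0 := Real.log_nonpos hN.le hN1
      have heq : (fun x => g x ^ 2 * Real.log (g x ^ 2)) =
          fun x => g x ^ 2 * Real.log (g x ^ 2 / N) + g x ^ 2 * Real.log N := by
        ext x
        by_cases hgx : g x = 0
        · simp [hgx]
        · rw [Real.log_div (pow_ne_zero 2 hgx) hN.ne']
          ring
      rw [heq]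
      refine ⟨h1.add (hgI.mul_const _), ?_⟩
      rw [integral_add h1 (hgI.mul_const _), integral_mul_const]
      have e1 := mul_le_mul_of_nonneg_left hQle hCD.le
      have e2 : N * Real.log N ≤ 0 := mul_nonpos_of_nonneg_of_nonpos hN.le hlogN
      linarith
  set F : M → ℝ := fun x =>
    f x ^ 2 - 1 + 25 * (|f x| - 1) ^ 2 + g x ^ 2 * Real.log (g x ^ 2) with hF
  have hF1 : Integrable (fun x => f x ^ 2 - 1) μ := hf2.sub (integrable_const 1)
  have hF2 : Integrable (fun x => f x ^ 2 - 1 + 25 * (|f x| - 1) ^ 2) μ :=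
    hF1.add (hEI.const_mul 25)
  have hFI : Integrable F μ := hF2.add hglog.1
  have hupper : ∀ x, f x ^ 2 * Real.log (f x ^ 2) ≤ F x := fun x =>
    sq_mul_log_sq_le (hg3 x) (hg0 x)
  have hlower : ∀ x, -1 ≤ f x ^ 2 * Real.log (f x ^ 2) := fun x => by
    by_cases hfx : f x = 0
    · simp [hfx]
    have hpos : 0 < f x ^ 2 := by positivity
    have e1 := mul_le_mul_of_nonneg_left (Real.one_sub_inv_le_log_of_pos hpos) hpos.le
    have e3 : f x ^ 2 * (1 - (f x ^ 2)⁻¹) = f x ^ 2 - 1 := by field_simp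
    linarith
  have hLI : Integrable (fun x => f x ^ 2 * Real.log (f x ^ 2)) μ := by
    have hmf : Measurable f := hfc.measurable
    refine Integrable.mono' (hFI.abs.add (integrable_const 1)) (by fun_prop)
      (Eventually.of_forall fun x => ?_)
    rw [Real.norm_eq_abs, abs_le]
    simp only [Pi.add_apply]
    have := hupper x
    have := hlower x
    have := le_abs_self (F x)
    have := abs_nonneg (F x)
    constructor <;> linarith
  refine ⟨hLI, (integral_mono hLI hFI hupper).trans ?_⟩
  simp only [hF]
  rw [integral_add hF2 hglog.1, integral_add hF1 (hEI.const_mul 25),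
    integral_sub hf2 (integrable_const 1), integral_const_mul, hf1]
  have e1 := hglog.2
  simp only [integral_const, probReal_univ, one_smul]
  linarith

/-- Both sides are homogeneous of degree two, since $|\nabla f|/f$ is unchanged when $f$ is
multiplied by a positive constant. -/
theorem modifiedLogSobolev (hP : LocalPoincare X ν x₀)
    {ε α β : ℝ} (hε : 0 < ε) (hα : 0 < α) (hβ : 0 < β) (hS : ClassicalSobolev X ν ε α β)
    {q : ℝ} (hq : (r + 1) / r ≤ q) :
    ∃ C : ℝ, 0 < C ∧ ∀ f : M → ℝ, LipDiff n ν f → Integrable (fun x => f x ^ 2) (gibbs ν U) →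
      Integrable (fun x => Hq q (‖subgrad X f x‖ / f x) * f x ^ 2) (gibbs ν U) →
      Integrable (fun x => f x ^ 2 * Real.log (f x ^ 2 / ∫ y, f y ^ 2 ∂(gibbs ν U)))
        (gibbs ν U) ∧
      ∫ x, f x ^ 2 * Real.log (f x ^ 2 / ∫ y, f y ^ 2 ∂(gibbs ν U)) ∂(gibbs ν U) ≤
        C * ∫ x, Hq q (‖subgrad X f x‖ / f x) * f x ^ 2 ∂(gibbs ν U) := by
  obtain ⟨C, hC, hmain⟩ := h.integrable_sq_mul_log_sq_of_integral_sq_eq_one hP hε hα hβ hS hq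
  refine ⟨C, hC, fun f hf hf2 hΓ => ?_⟩
  set μ := gibbs ν U with hμ
  have hΓ0 : 0 ≤ ∫ x, Hq q (‖subgrad X f x‖ / f x) * f x ^ 2 ∂μ :=
    integral_nonneg fun x => mul_nonneg (Hq_nonneg _ _) (sq_nonneg _)
  rcases (integral_nonneg (μ := μ) (f := fun x => f x ^ 2) fun x => sq_nonneg (f x)).eq_or_lt with hN | hN
  · have hzero : (fun x => f x ^ 2 * Real.log (f x ^ 2 / ∫ y, f y ^ 2 ∂μ)) =ᵐ[μ] 0 := by
      rw [← hN]
      filter_upwards with x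
      simp
    refine ⟨(integrable_zero _ _ _).congr hzero.symm, ?_⟩
    rw [integral_congr_ae hzero]
    simp only [Pi.zero_apply, integral_zero]
    positivity
  · set N := ∫ x, f x ^ 2 ∂μ with hNdef
    set c : ℝ := (Real.sqrt N)⁻¹ with hc
    have hc0 : 0 < c := by have := Real.sqrt_pos.2 hN; positivity
    have hc2 : c ^ 2 = N⁻¹ := by rw [hc, inv_pow, Real.sq_sqrt hN.le]
    have hder : ∀ t : ℝ, HasDerivAt (fun t : ℝ => c * t) c t := fun t => by
      simpa using (hasDerivAt_id t).const_mul c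
    have hu : LipDiff n ν fun x => c * f x := hf.comp (Φ := fun t => c * t) fun x => by fun_prop
    have hu2 : (fun x => (c * f x) ^ 2) = fun x => N⁻¹ * f x ^ 2 := by
      ext x
      rw [mul_pow, hc2]
    have hΓu : (fun x => Hq q (‖subgrad X (fun y => c * f y) x‖ / (c * f x)) * (c * f x) ^ 2)
        =ᵐ[μ] fun x => N⁻¹ * (Hq q (‖subgrad X f x‖ / f x) * f x ^ 2) := by
      filter_upwards [gibbs_absolutelyContinuous hf.2] with x hx
      rw [subgrad_comp X hx (hder _), norm_smul, Real.norm_of_nonneg hc0.le,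
        mul_div_mul_left _ _ hc0.ne', mul_pow, hc2]
      ring
    obtain ⟨h1, h2⟩ := hmain _ hu (by rw [hu2]; exact hf2.const_mul _)
      (by rw [hu2, integral_const_mul, ← hNdef, inv_mul_cancel₀ hN.ne'])
      ((hΓ.const_mul _).congr hΓu.symm)
    rw [integral_congr_ae hΓu, integral_const_mul] at h2
    have heq : (fun x => f x ^ 2 * Real.log (f x ^ 2 / N)) =
        fun x => N * ((c * f x) ^ 2 * Real.log ((c * f x) ^ 2)) := by
      ext x
      rw [mul_pow, hc2, ← mul_assoc, ← mul_assoc, mul_inv_cancel₀ hN.ne', one_mul,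
        inv_mul_eq_div]
    rw [heq, integral_const_mul]
    refine ⟨h1.const_mul N, ?_⟩
    refine (mul_le_mul_of_nonneg_left h2 hN.le).trans (le_of_eq ?_)
    field_simp

end Confining
end

/-! ### Verification that $d^p+W$ is a confining potential. -/

section

variable {n m : ℕ} {M : Type*} [MetricSpace M] [ChartedSpace (EuclideanSpace ℝ (Fin n)) M]
    [MeasurableSpace M] {ν : Measure M} {X : Fin m → (x : M) → TangentSpace (𝓡 n) x} {x₀ : M}

lemma LipDiff.dist_rpow (hd : LipDiff n ν fun y => dist x₀ y) {p : ℝ} (hp : 1 ≤ p) :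
    LipDiff n ν fun x => dist x₀ x ^ p :=
  hd.comp (Φ := fun t => t ^ p) fun _ =>
    (Real.contDiff_rpow_const_of_le (n := 1) (by simpa using hp)).contDiffAt

omit [MeasurableSpace M] in
lemma subgrad_dist_rpow {p : ℝ} (hp : 1 ≤ p) {x : M}
    (hx : MDifferentiableAt (𝓡 n) 𝓘(ℝ, ℝ) (fun y => dist x₀ y) x) :
    subgrad X (fun y => dist x₀ y ^ p) x =
      (p * dist x₀ x ^ (p - 1)) • subgrad X (fun y => dist x₀ y) x :=
  subgrad_comp X hx (Φ := fun t => t ^ p) (Real.hasDerivAt_rpow_const (Or.inr hp))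

/-- Gradients cannot be integrated along curves here; only the intrinsic distance is available. With
$S=d^{r+1}+1+\sqrt{1+W^2}$ one has $|\nabla S|\le CS^{r/(r+1)}$, so $S^{1/(r+1)}$ has bounded
gradient and is Lipschitz. It grows at most linearly, and $W\le S$. Since $S\ge1$, the root is
differentiable. -/
lemma exists_le_mul_one_add_dist_rpow {L : ℝ≥0}
    (hL : ∀ x y : M, intrinsicEDist X ν x y ≤ L * edist x y)
    (hd : LipDiff n ν fun y => dist x₀ y)
    (hd1 : ∀ᵐ x ∂ν, ‖subgrad X (fun y => dist x₀ y) x‖ ≤ 1) {r δ γ : ℝ} (hr : 0 < r)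
    (hδ : 0 < δ) (hγ : 0 < γ) {W : M → ℝ} (hW : LipDiff n ν W)
    (hWg : ∀ᵐ x ∂ν, ‖subgrad X W x‖ ≤ δ * dist x₀ x ^ r + γ) :
    ∃ A : ℝ, 0 < A ∧ ∀ x, W x ≤ A * (1 + dist x₀ x ^ (r + 1)) := by
  have hp : (1 : ℝ) ≤ r + 1 := by linarith
  have hp0 : (0 : ℝ) < r + 1 := by linarith
  have hpos : ∀ t : ℝ, 0 < 1 + t ^ 2 := fun t => by positivity
  set S : M → ℝ := fun x => dist x₀ x ^ (r + 1) + (1 + Real.sqrt (1 + W x ^ 2)) with hS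
  have hV : LipDiff n ν fun x => 1 + Real.sqrt (1 + W x ^ 2) :=
    hW.comp (Φ := fun t => 1 + Real.sqrt (1 + t ^ 2)) fun x =>
      contDiffAt_const.add (ContDiffAt.sqrt (by fun_prop) (hpos _).ne')
  have hSL : LipDiff n ν S := (hd.dist_rpow hp).add hV
  have hS1 : ∀ x, 1 ≤ S x := fun x => by
    have : 0 ≤ dist x₀ x ^ (r + 1) := by positivity
    have := Real.sqrt_nonneg (1 + W x ^ 2)
    simp only [hS]; linarith
  have hSd : ∀ x, dist x₀ x ^ (r + 1) ≤ S x := fun x => by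
    have := Real.sqrt_nonneg (1 + W x ^ 2)
    simp only [hS]; linarith
  have hWS : ∀ x, W x ≤ S x := fun x => by
    have h1 : |W x| ≤ Real.sqrt (1 + W x ^ 2) := Real.abs_le_sqrt (by linarith)
    have h2 : 0 ≤ dist x₀ x ^ (r + 1) := by positivity
    simp only [hS]; linarith [le_abs_self (W x)]
  set T : M → ℝ := fun x => S x ^ (r + 1)⁻¹ with hT
  have hTL : LipDiff n ν T := hSL.comp (Φ := fun t => t ^ (r + 1)⁻¹) fun x =>
    Real.contDiffAt_rpow_const_of_ne (by linarith [hS1 x])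
  set C : ℝ := r + 1 + δ + γ with hC
  have hC0 : 0 < C := by positivity
  have hTg : ∀ᵐ x ∂ν, ‖subgrad X T x‖ ≤ C := by
    filter_upwards [hd.2, hW.2, hd1, hWg, hSL.2, (hd.dist_rpow hp).2, hV.2]
      with x e1 e2 e3 e4 e5 e6 e7
    have hSx := hS1 x
    have hder : HasDerivAt (fun t : ℝ => 1 + Real.sqrt (1 + t ^ 2))
        (2 * W x / (2 * Real.sqrt (1 + W x ^ 2))) (W x) := by
      have h0 : HasDerivAt (fun t : ℝ => 1 + t ^ 2) (2 * W x) (W x) := by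
        simpa using (hasDerivAt_pow 2 (W x)).const_add 1
      exact (h0.sqrt (hpos _).ne').const_add 1
    have hSg : ‖subgrad X S x‖ ≤ (r + 1) * dist x₀ x ^ r + (δ * dist x₀ x ^ r + γ) := by
      rw [hS, subgrad_add X e6 e7, subgrad_dist_rpow hp e1, subgrad_comp X e2 hder]
      refine (norm_add_le _ _).trans ?_
      rw [norm_smul, norm_smul, add_sub_cancel_right,
        Real.norm_of_nonneg (by positivity : 0 ≤ (r + 1) * dist x₀ x ^ r)]
      refine add_le_add (mul_le_of_le_one_right (by positivity) e3) ((mul_le_of_le_one_left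
        (norm_nonneg _) ?_).trans e4)
      have hs := Real.sqrt_pos.2 (hpos (W x))
      rw [mul_div_mul_left _ _ two_ne_zero, norm_div, Real.norm_of_nonneg hs.le, div_le_one hs]
      exact Real.abs_le_sqrt (by linarith)
    set Y := S x ^ (r / (r + 1)) with hY
    have hY1 : 1 ≤ Y := Real.one_le_rpow hSx (by positivity)
    have hYd : dist x₀ x ^ r ≤ Y := by
      have := Real.rpow_le_rpow (by positivity) (hSd x) (by positivity : 0 ≤ r / (r + 1))
      rwa [← Real.rpow_mul dist_nonneg, mul_div_cancel₀ _ hp0.ne'] at this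
    have hTder := Real.hasDerivAt_rpow_const (x := S x) (p := (r + 1)⁻¹)
      (Or.inl (by linarith))
    rw [hT, subgrad_comp X e5 (Φ := fun t => t ^ (r + 1)⁻¹) hTder, norm_smul]
    have hexp : S x ^ ((r + 1)⁻¹ - 1) = Y⁻¹ := by
      rw [hY, ← Real.rpow_neg (by linarith)]
      congr 1
      field_simp
      ring
    rw [hexp, Real.norm_of_nonneg (by positivity)]
    have h1 : ‖subgrad X S x‖ ≤ C * Y := by
      have h2 := mul_le_mul_of_nonneg_left hYd hp0.le
      have h3 := mul_le_mul_of_nonneg_left hYd hδ.le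
      have h4 := mul_le_mul_of_nonneg_left hY1 hγ.le
      rw [hC]
      linarith
    have h2 : (r + 1)⁻¹ ≤ 1 := inv_le_one_of_one_le₀ hp
    calc (r + 1)⁻¹ * Y⁻¹ * ‖subgrad X S x‖ ≤ 1 * Y⁻¹ * (C * Y) := by gcongr
      _ = C := by field_simp
  have hlip := dist_le_of_norm_subgrad_le hL hTL.isTestFunction hC0 hTg
  have hT0 : ∀ x, 0 < T x := fun x => Real.rpow_pos_of_pos (by linarith [hS1 x]) _
  set b : ℝ := C * L with hb
  have hb0 : 0 ≤ b := by positivity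
  refine ⟨(T x₀ + b) ^ (r + 1), Real.rpow_pos_of_pos (by linarith [hT0 x₀]) _, fun x => ?_⟩
  have h1 : T x ≤ T x₀ + b * dist x₀ x := by
    have := hlip x x₀
    rw [Real.dist_eq, dist_comm] at this
    linarith [le_abs_self (T x - T x₀)]
  have h2 : S x = T x ^ (r + 1) := by
    simp only [hT]
    rw [← Real.rpow_mul (by linarith [hS1 x]), inv_mul_cancel₀ hp0.ne', Real.rpow_one]
  refine (hWS x).trans ?_
  rw [h2]
  have hd0 : 0 ≤ dist x₀ x := dist_nonneg
  have h3 : 0 ≤ (T x₀ + b) ^ (r + 1) := Real.rpow_nonneg (by linarith [hT0 x₀]) _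
  have h4 : 0 ≤ dist x₀ x ^ (r + 1) := by positivity
  rcases le_total (dist x₀ x) 1 with hx | hx
  · have h5 : T x ≤ T x₀ + b := by nlinarith
    have h6 := Real.rpow_le_rpow (hT0 x).le h5 hp0.le
    nlinarith
  · have h5 : T x ≤ (T x₀ + b) * dist x₀ x := by nlinarith [hT0 x₀]
    have h6 := Real.rpow_le_rpow (hT0 x).le h5 hp0.le
    rw [Real.mul_rpow (by linarith [hT0 x₀]) hd0] at h6
    linarith

omit [MetricSpace M] in
-- `tilted` is the zero measure when the exponential is not integrable, so a probability measure
-- forces both normalisations to be genuine. The constant is $z=\log\int e^{-f-g}d\nu$.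
lemma tilted_tilted_eq_gibbs {f g : M → ℝ}
    (h : IsProbabilityMeasure ((ν.tilted fun x => -f x).tilted fun x => -g x)) :
    ∃ z : ℝ, (ν.tilted fun x => -f x).tilted (fun x => -g x) = gibbs ν fun x => f x + (g x + z) := by
  have hne : (ν.tilted fun x => -f x).tilted (fun x => -g x) ≠ 0 := h.ne_zero
  have hf : Integrable (fun x => Real.exp (-f x)) ν := by
    by_contra hf
    rw [tilted_of_not_integrable hf, tilted_zero_measure] at hne
    exact hne rfl
  rw [tilted_tilted hf] at hne ⊢
  have hfg : Integrable (fun x => Real.exp (((fun x => -f x) + fun x => -g x) x)) ν := by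
    by_contra hfg
    exact hne (tilted_of_not_integrable hfg)
  have hν : NeZero ν := ⟨fun h0 => hne (by rw [h0, tilted_zero_measure])⟩
  have hZ := integral_exp_pos hfg
  refine ⟨Real.log (∫ x, Real.exp (((fun x => -f x) + fun x => -g x) x) ∂ν), ?_⟩
  rw [Measure.tilted, gibbs]
  congr with x
  congr 1
  nth_rewrite 1 [← Real.exp_log hZ]
  rw [← Real.exp_sub]
  congr 1
  simp only [Pi.add_apply]
  ring

/-- The drift is at least $(r+1)d^r|\nabla d|^2-|\nabla W|\ge d^r/\sigma^2-\delta d^r-\gamma\ge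
d^r/(2\sigma^2)-\gamma$. -/
lemma confining_dist_rpow_add [IsManifold (𝓡 n) ∞ M] [BorelSpace M] [SecondCountableTopology M]
    (hX : ∀ i, ContMDiff (𝓡 n) (𝓡 n).tangent ∞
      (fun x => (⟨x, X i x⟩ : TangentBundle (𝓡 n) M))) {L : ℝ≥0}
    (hL : ∀ x y : M, intrinsicEDist X ν x y ≤ L * edist x y) {σ K : ℝ} (hσ : 1 ≤ σ) (hK : 0 < K)
    (hd : ∀ᵐ x ∂ν, 1 / σ < ‖subgrad X (fun y => dist x₀ y) x‖ ∧
      ‖subgrad X (fun y => dist x₀ y) x‖ ≤ 1)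
    (hΔ : LaplacianLEOn X ν (fun y => dist x₀ y) {x | 1 < dist x₀ x} K)
    {r δ γ : ℝ} (hr : 0 < r) (hr1 : r < 1) (hδ : 0 < δ) (hδσ : δ ≤ 1 / (2 * σ ^ 2)) (hγ : 0 < γ)
    {W : M → ℝ} (hW : LipDiff n ν W) (hWg : ∀ᵐ x ∂ν, ‖subgrad X W x‖ ≤ δ * dist x₀ x ^ r + γ)
    (z : ℝ) :
    Confining X ν x₀ (fun x => dist x₀ x ^ (r + 1) + (W x + z)) r := by
  have hσ0 : 0 < σ := by linarith
  have hp : (1 : ℝ) ≤ r + 1 := by linarith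
  have hdL : LipDiff n ν fun y => dist x₀ y := by
    refine ⟨(LipschitzWith.dist_right x₀).locallyLipschitz, ?_⟩
    filter_upwards [hd] with x hx
    refine mdifferentiableAt_of_subgrad_ne_zero X (norm_pos_iff.1 (lt_trans ?_ hx.1))
    positivity
  have hd1 : ∀ᵐ x ∂ν, ‖subgrad X (fun y => dist x₀ y) x‖ ≤ 1 := hd.mono fun x hx => hx.2
  have hWz : LipDiff n ν fun x => W x + z := hW.comp (Φ := fun t => t + z) fun x => by fun_prop
  have hgrad : ∀ᵐ x ∂ν, subgrad X (fun x => dist x₀ x ^ (r + 1) + (W x + z)) x =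
      ((r + 1) * dist x₀ x ^ r) • subgrad X (fun y => dist x₀ y) x + subgrad X W x := by
    filter_upwards [hdL.2, (hdL.dist_rpow hp).2, hW.2, hWz.2] with x e1 e2 e3 e4
    rw [subgrad_add X e2 e4, subgrad_dist_rpow hp e1, add_sub_cancel_right,
      subgrad_comp X e3 (Φ := fun t => t + z) ((hasDerivAt_id (W x)).add_const z), one_smul]
  refine ⟨fun f hf => aemeasurable_subgrad hX hf.2, hr, hr1, hdL, hd1, ⟨K, hK, hΔ⟩,
    (hdL.dist_rpow hp).add hWz, ⟨1 / (2 * σ ^ 2), γ, by positivity, hγ, ?_⟩,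
    ⟨r + 1 + δ + γ, by positivity, ?_⟩, ?_⟩
  · filter_upwards [hgrad, hd, hWg] with x e1 e2 e3
    rw [e1, inner_add_right, inner_smul_right, real_inner_self_eq_norm_sq]
    have hdr : 0 ≤ dist x₀ x ^ r := by positivity
    have e4 := abs_real_inner_le_norm (subgrad X (fun y => dist x₀ y) x) (subgrad X W x)
    have e5 := mul_le_of_le_one_left (norm_nonneg (subgrad X W x)) e2.2
    have e6 := neg_abs_le (inner ℝ (subgrad X (fun y => dist x₀ y) x) (subgrad X W x))
    have e7 : 1 / σ ^ 2 ≤ ‖subgrad X (fun y => dist x₀ y) x‖ ^ 2 := by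
      have := pow_le_pow_left₀ (by positivity) e2.1.le 2
      rwa [div_pow, one_pow] at this
    have e8 := mul_le_mul_of_nonneg_left e7 hdr
    have e9 := mul_le_mul_of_nonneg_right hδσ hdr
    have e10 : 1 / σ ^ 2 = 2 * (1 / (2 * σ ^ 2)) := by field_simp
    rw [e10] at e8
    have e11 : 0 ≤ r * (dist x₀ x ^ r * ‖subgrad X (fun y => dist x₀ y) x‖ ^ 2) := by positivity
    linarith
  · filter_upwards [hgrad, hd1, hWg] with x e1 e2 e3
    rw [e1]
    refine (norm_add_le _ _).trans ?_
    have hdr : 0 ≤ dist x₀ x ^ r := by positivity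
    rw [norm_smul, Real.norm_of_nonneg (by positivity)]
    have e4 := mul_le_of_le_one_right (by positivity : 0 ≤ (r + 1) * dist x₀ x ^ r) e2
    have e5 : 0 ≤ γ * dist x₀ x ^ r := by positivity
    linarith
  · obtain ⟨A, hA, hWA⟩ := exists_le_mul_one_add_dist_rpow hL hdL hd1 hr hδ hγ hW hWg
    refine ⟨1 + A + |z|, by positivity, fun x => ?_⟩
    have h1 : 0 ≤ dist x₀ x ^ (r + 1) := by positivity
    have h2 : 0 ≤ |z| * dist x₀ x ^ (r + 1) := by positivity
    linarith [hWA x, le_abs_self z]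

end

theorem theorem1 {n m : ℕ} {M : Type*} [MetricSpace M] [ProperSpace M]
    [ChartedSpace (EuclideanSpace ℝ (Fin n)) M]
    [IsManifold 𝓘(ℝ, EuclideanSpace ℝ (Fin n)) ∞ M]
    [MeasurableSpace M] [BorelSpace M]
    -- the smooth vector fields that define the (sub)gradient
    (X : Fin m → (x : M) → TangentSpace 𝓘(ℝ, EuclideanSpace ℝ (Fin n)) x)
    (hX : ∀ i, ContMDiff 𝓘(ℝ, EuclideanSpace ℝ (Fin n))
      𝓘(ℝ, EuclideanSpace ℝ (Fin n)).tangent ∞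
      (fun x => (⟨x, X i x⟩ : TangentBundle 𝓘(ℝ, EuclideanSpace ℝ (Fin n)) M)))
    (lam : Measure M) (hlam : IsVolume n lam)
    -- the intrinsic distance of the (sub)gradient is at most a multiple of the distance
    (L : ℝ≥0) (hL : ∀ x y : M, intrinsicEDist X lam x y ≤ L * edist x y)
    (x₀ : M) (σ K : ℝ) (hσ : 1 ≤ σ) (hK : 0 < K)
    (hd : ∀ᵐ x ∂lam, 1 / σ < ‖subgrad X (fun y => dist x₀ y) x‖ ∧
      ‖subgrad X (fun y => dist x₀ y) x‖ ≤ 1)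
    (hΔ : LaplacianLEOn X lam (fun y => dist x₀ y) {x | 1 < dist x₀ x} K)
    (ε α β : ℝ) (hε : 0 < ε) (hα : 0 < α) (hβ : 0 < β)
    (hS : ClassicalSobolev X lam ε α β)
    (hP : LocalPoincare X lam x₀) :
    ∃ δ₀ : ℝ, 0 < δ₀ ∧ δ₀ < 1 ∧
      ∀ q p : ℝ, 2 < q → 1 < p → p < 2 → q / (q - 1) ≤ p →
      ∀ δ γ : ℝ, 0 < δ → δ ≤ δ₀ → 0 < γ →
      ∀ W : M → ℝ, IsTestFunction n lam W →
        (∀ᵐ x ∂lam, ‖subgrad X W x‖ ≤ δ * dist x₀ x ^ (p - 1) + γ) →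
        IsProbabilityMeasure ((muP lam x₀ p).tilted fun x => -W x) →
          ModifiedLogSobolev X ((muP lam x₀ p).tilted fun x => -W x) q := by
  have hloc : IsLocallyFiniteMeasure lam := hlam.isLocallyFiniteMeasure
  have hσ2 : 1 ≤ σ ^ 2 := one_le_pow₀ hσ
  -- This choice lets $W$ consume at most half of the lower bound $d^r/\sigma^2$ for the drift of
  -- $d^p$.
  refine ⟨1 / (2 * σ ^ 2), by positivity, ?_, ?_⟩
  · rw [div_lt_one (by positivity)]
    linarith
  intro q p hq hp1 hp2 hqp δ γ hδ hδ₀ hγ W hW hWg hprob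
  obtain ⟨r, rfl⟩ : ∃ r, p = r + 1 := ⟨p - 1, by ring⟩
  rw [add_sub_cancel_right] at hWg
  have hr : 0 < r := by linarith
  have hWL : LipDiff n lam W := hW.lipDiff hX hL
  unfold muP at hprob ⊢
  obtain ⟨z, hz⟩ := tilted_tilted_eq_gibbs hprob
  rw [hz] at hprob ⊢
  have hconf := confining_dist_rpow_add hX hL hσ hK hd hΔ hr (by linarith) hδ hδ₀ hγ hWL hWg z
  -- The condition $p\ge q/(q-1)$ says that the conjugate exponent $p'=(r+1)/r$ is at most $q$.
  have hqr : (r + 1) / r ≤ q := by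
    rw [div_le_iff₀ (by linarith)] at hqp
    rw [div_le_iff₀ hr]
    linarith
  obtain ⟨c, hc, hmain⟩ := hconf.modifiedLogSobolev hP hε hα hβ hS hqr
  refine ⟨c, hc, fun f hf hf2 hΓ => hmain f ?_ hf2.integrable_sq hΓ⟩
  -- The density $e^{-U}$ is positive, so differentiability $\mu$-a.e. is differentiability
  -- $\lambda$-a.e.
  exact (hf.lipDiff hX hL).mono_ae (absolutelyContinuous_gibbs hconf.pot.continuous)
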